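/- Let $F/\mathbb F_b$ be an algebraic function field in one variable over the finite field $\mathbb F_b$ with $b$ elements, with full constant field $\mathbb F_b$ and genus $g$. For a divisor $D$ let $\mathcal L(D)=\{f\in F\setminus\{0\} : \operatorname{div}(f)+D\ge 0\}\cup\{0\}$. Let $s\ge 1$, let $P_\infty$ be a place of degree $1$, let $P_0\ne P_\infty$ be a place, and let $P_{i,j}$ ($1\le i\le s$, $j\ge 1$) be places different from $P_0$ and $P_\infty$ such that $P_{i_1,j_1}\ne P_{i_2,j_2}$ whenever $i_1\neq i_2$. Put $P_{0,j}=P_0$ for $j\ge1$. For $0\le i\le s$ and $j\ge 0$ let $\mathcal P_{i,j}=P_{i,1}+\dots+P_{i,j}$ (as a divisor, written additively; $\mathcal P_{i,0}=0$) and $n_{i,j}=\deg \mathcal P_{i,j}$. Let $O_F=\bigcap_{P\ne P_\infty}O_P$ be the ring of functions that are regular outside $P_\infty$. For each $i\in\{0,\dots,s\}$ let $(w^{(i)}_l)_{l\ge 0}$ be an $\mathbb F_b$-linear basis of $O_F$ which is obtained from the chain $(\mathcal P_{i,j})_j$ as follows: for every $j\ge 1$ there is a basis $u_1,\dots,u_g$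 of $\mathcal L((n_{i,j}+2g-1)P_\infty-\mathcal P_{i,j})$ such that $w^{(i)}_{n_{i,j-1}},\dots,w^{(i)}_{n_{i,j}-1},u_1,\dots,u_g$ is a basis of $\mathcal L((n_{i,j}+2g-1)P_\infty-\mathcal P_{i,j-1})$. Define $c^{(i)}_{j,r}\in\mathbb F_b$ ($1\le i\le s$, $j\ge1$, $r\ge0$) by the finite expansions $w^{(0)}_r=\sum_{j\ge1}c^{(i)}_{j,r}\,w^{(i)}_{j-1}$. Fix a bijection $\phi:\{0,1,\dots,b-1\}\to\mathbb F_b$ with $\phi(0)=0$. For an integer $n\ge0$ with $b$-adic expansion $n=\sum_{r\ge0}a_r(n)b^r$ put $$y^{(i)}_{n,j}=\sum_{r\ge0}\phi(a_r(n))\,c^{(i)}_{j,r},\qquad x^{(i)}_n=\sum_{j\ge1}\phi^{-1}(y^{(i)}_{n,j})\,b^{-j},\qquad \mathbf x_n=(x^{(1)}_n,\dots,x^{(s)}_n)$$ (the generalized Halton-type sequence). Let $\gamma_1,\dots,\gamma_s\in(0,1)$ have $b$-adic expansions $\gamma_i=\sum_{j\ge1}\gamma_{i,j}b^{-j}$,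 where $\gamma_{i,j}\in\{0,\dots,b-1\}$ and $\gamma_{i,j}\ne b-1$ for infinitely many $j$. Then the box $S=[0,\gamma_1)\times\dots\times[0,\gamma_s)$ is a bounded remainder set for $(\mathbf x_n)_{n\ge0}$, i.e. $\sum_{n=0}^{N-1}(\mathbf 1_S(\mathbf x_n)-\gamma_1\cdots\gamma_s)$ is bounded in $N$, if and only if for every $i$ only finitely many digits $\gamma_{i,j}$, $j\ge1$, are non-zero, i.e. $\max_{1\le i\le s}\max\{j\ge1:\gamma_{i,j}\ne0\}<\infty$. -/

import Mathlib

noncomputable section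

namespace HaltonFF

/-- A place of `F/K`, given by its valuation ring `O` with `K ⊆ O ≠ F`
(the place itself is the maximal ideal of `O`, which determines `O`). -/
structure Place (K F : Type*) [Field K] [Field F] [Algebra K F] where
  /-- the valuation ring of the place -/
  ring : ValuationSubring F
  algebraMap_mem : ∀ c : K, algebraMap K F c ∈ ring
  ne_top : ring ≠ ⊤

namespace Place

variable {K F : Type*} [Field K] [Field F] [Algebra K F]

instance algebraRing (P : Place K F) : Algebra K P.ring :=
  ((algebraMap K F).codRestrict P.ring.toSubring P.algebraMap_mem).toAlgebra

/-- The degree of a place: the degree over `K` of its residue field. -/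
def deg (P : Place K F) : ℕ :=
  Module.finrank K (IsLocalRing.ResidueField P.ring)

/-- For `f` in the valuation ring, `f ≠ 0`: the largest `n` such that `f` lies in the `n`-th power
of the maximal ideal. -/
def ordNat (P : Place K F) (f : F) : ℕ :=
  sSup {n : ℕ | ∃ a : P.ring, a ∈ IsLocalRing.maximalIdeal P.ring ^ n ∧ (a : F) = f}

open scoped Classical in
/-- The normalized discrete valuation of the place at `f ≠ 0` (only used for `f ≠ 0`). -/
def ord (P : Place K F) (f : F) : ℤ :=
  if f ∈ P.ring then (P.ordNat f : ℤ) else -(P.ordNat f⁻¹ : ℤ)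

end Place

/-- Divisors of `F/K`: the free abelian group on the places. -/
abbrev Divisor (K F : Type*) [Field K] [Field F] [Algebra K F] : Type _ :=
  Place K F →₀ ℤ

section FunctionField

variable {K F : Type*} [Field K] [Field F] [Algebra K F]

/-- The degree of a divisor. -/
def Divisor.deg (D : Divisor K F) : ℤ :=
  D.sum fun P n => n * (P.deg : ℤ)

/-- The Riemann–Roch space `L(D) = {f ≠ 0 | div f + D ≥ 0} ∪ {0}`. -/
def rrSpace (D : Divisor K F) : Set F :=
  {f : F | f ≠ 0 ∧ ∀ P : Place K F, 0 ≤ P.ord f + D P} ∪ {0}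

/-- The dimension `ℓ(D)` of the `K`-vector space `L(D)`. -/
def rrDim (D : Divisor K F) : ℕ :=
  Module.finrank K (Submodule.span K (rrSpace D))

/-- The genus of `F/K`: the maximum of `deg D - ℓ(D) + 1` over all divisors `D`
(it is at least `0`, as `D = 0` shows). -/
def genus (K F : Type*) [Field K] [Field F] [Algebra K F] : ℕ :=
  (sSup (Set.range fun D : Divisor K F => D.deg - (rrDim D : ℤ) + 1)).toNat

/-- The holomorphy ring `O_F`: the intersection of the valuation rings of all places
other than `Pinf`. -/
def holomorphyRing (Pinf : Place K F) : Subalgebra K F where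
  carrier := {f : F | ∀ P : Place K F, P ≠ Pinf → f ∈ P.ring}
  mul_mem' hf hg P hP := P.ring.mul_mem _ _ (hf P hP) (hg P hP)
  add_mem' hf hg P hP := P.ring.add_mem _ _ (hf P hP) (hg P hP)
  algebraMap_mem' c P _ := P.algebraMap_mem c

/-- The family `e` is a `K`-linear basis of the subspace `S` of `F`. -/
def IsBasisOf (K : Type*) {F ι : Type*} [Field K] [Field F] [Algebra K F]
    (e : ι → F) (S : Set F) : Prop :=
  LinearIndependent K e ∧ (Submodule.span K (Set.range e) : Set F) = S

/-- For a sequence of places `Q 0, Q 1, …`, the divisor `Q 0 + ⋯ + Q (j - 1)`. -/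
def chainDivisor (Q : ℕ → Place K F) (j : ℕ) : Divisor K F :=
  ∑ k ∈ Finset.range j, Finsupp.single (Q k) 1

/-- The degree `n_j` of `Q 0 + ⋯ + Q (j - 1)`. -/
def chainDegree (Q : ℕ → Place K F) (j : ℕ) : ℕ :=
  ∑ k ∈ Finset.range j, (Q k).deg

/-- The divisor `(n_{j+1} + 2g - 1) Pinf`, where `n_{j+1} = deg (Q 0 + ⋯ + Q j)`. -/
def poleDivisor (Pinf : Place K F) (Q : ℕ → Place K F) (j : ℕ) : Divisor K F :=
  Finsupp.single Pinf ((chainDegree Q (j + 1) : ℤ) + 2 * (genus K F : ℤ) - 1)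

/-- The sequence `w` is obtained from the chain `Q 0, Q 0 + Q 1, …` by the block construction:
with `n_j = deg (Q 0 + ⋯ + Q (j - 1))` and `A = (n_{j+1} + 2g - 1) Pinf`, the `j`-th block
`w (n_j), …, w (n_{j+1} - 1)` extends some basis `u` of `L(A - (Q 0 + ⋯ + Q j))`, which has
`g` elements, to a basis of `L(A - (Q 0 + ⋯ + Q (j - 1)))`. -/
def IsBlockSequence (Pinf : Place K F) (Q : ℕ → Place K F) (w : ℕ → F) : Prop :=
  ∀ j : ℕ, ∃ u : Fin (genus K F) → F,
    IsBasisOf K u (rrSpace (poleDivisor Pinf Q j - chainDivisor Q (j + 1))) ∧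
    IsBasisOf K (Sum.elim (fun μ : Fin (Q j).deg => w (chainDegree Q j + μ)) u)
      (rrSpace (poleDivisor Pinf Q j - chainDivisor Q j))

/-- The `s + 1` sequences of places: the constant sequence `P₀` at index `0`, followed by
the `s` given sequences. -/
def placeChain {s : ℕ} (P₀ : Place K F) (P : Fin s → ℕ → Place K F) :
    Fin (s + 1) → ℕ → Place K F :=
  Fin.cons (fun _ => P₀) P

/-- The generating matrices: `w 0 r = ∑ j, c i j r • w i j`, for bases `w 0, …, w s` of `O_F`;
coordinate `i : Fin s` belongs to the basis `w i.succ`. -/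
def generatingMatrix {s : ℕ} {Pinf : Place K F}
    (w : Fin (s + 1) → Module.Basis ℕ K (holomorphyRing Pinf)) (i : Fin s) (j r : ℕ) : K :=
  (w i.succ).repr (w 0 r) j

end FunctionField

section Digital

variable {K : Type*} [Field K] {b : ℕ} [NeZero b]

/-- The digit of `b ^ r` in the `b`-adic expansion of `n`. -/
def natDigit (b : ℕ) [NeZero b] (n r : ℕ) : Fin b := Fin.ofNat b (n / b ^ r)

/-- The digit vectors `y i n j = ∑ r, φ (a_r(n)) * c i j r`, where `n = ∑ r, a_r(n) b ^ r`;
`a_r(n) = 0` for `r ≥ n` if `b ≥ 2`, and `φ 0 = 0`. -/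
def digitalVector {s : ℕ} (φ : Fin b ≃ K) (c : Fin s → ℕ → ℕ → K) (n : ℕ) (i : Fin s) (j : ℕ) : K :=
  ∑ r ∈ Finset.range n, φ (natDigit b n r) * c i j r

/-- The digital sequence with generating matrices `c`: the `i`-th coordinate of the `n`-th point is
`∑ j, φ⁻¹ (y i n j) / b ^ (j + 1)`. -/
def digitalSequence {s : ℕ} (φ : Fin b ≃ K) (c : Fin s → ℕ → ℕ → K) (n : ℕ) : Fin s → ℝ :=
  fun i => Real.ofDigits fun j => φ.symm (digitalVector φ c n i j)

end Digital

/-- `S` is a bounded remainder set for the sequence `x`: the discrepancy function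
`∑ n < N, (1_S (x n) - λ(S))` is bounded in `N`. -/
def IsBoundedRemainderSet {s : ℕ} (x : ℕ → Fin s → ℝ) (S : Set (Fin s → ℝ)) : Prop :=
  ∃ C : ℝ, ∀ N : ℕ,
    |∑ n ∈ Finset.range N,
      (S.indicator (fun _ => (1 : ℝ)) (x n) - (MeasureTheory.volume S).toReal)| ≤ C

end HaltonFF

end

/-! Everything reduces to linear algebra on the `K`-space `O_F` with its `s + 1` bases. The digits
of `n`, taken as coordinates in `w 0`, give a vector `digitPoint`, and its coordinates in `w i.succ`
are the digits of the `i`-th coordinate of the `n`-th point. The only arithmetic input is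
`exists_repr_eq`: finitely many coordinates in all the bases can be prescribed at once. Vanishing of
initial coordinates means membership in a chain ideal (`mem_chainIdeal_iff_repr`), ideals of
different chains are coprime because a place other than `Pinf` in a chain is determined by its
center on `O_F` (`place_eq_of_centerIdeal_eq`), and the Chinese remainder theorem applies.

If all the `γ i` have finitely many nonzero digits, membership in the box depends on finitely many
coordinates. These are exactly equidistributed over every aligned block of `b ^ R` points
(`sum_digitPoint_eq`), so the discrepancy vanishes on full blocks and stays bounded.

Conversely, suppose the discrepancy is bounded by `C` and some `γ i₀` has infinitely many nonzero
digits. Joint independence turns the discrepancy of the first `N` points, translated by any block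
`Y` of `M` digits, into a difference of two values of the original one, up to rare ties; so its mean
square over `Y` is at most `4 * C ^ 2 + 1`. Infinitely many places `l` of `γ i₀` are mixed. Each
gives a functional in the first `l + 1` coordinates that kills the first `ρ ≥ l` vectors of `w 0`
but not the next one (`exists_coordFunctional`). Composed with two-point functions of sum zero,
these functionals give an orthogonal family. For `N = ∑ b ^ (ρ t - 1)`, every member correlates with
the translated discrepancy to an amount independent of `t`: about `b ^ l` uncancelled points make up
for the measure, about `b ^ (-l)`, of a cylinder (`card_cylinder_le_sum_inBox`). Bessel's inequality
then bounds the number of members, a contradiction. -/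

noncomputable section
namespace HaltonFF

/-! ### Finiteness of a function field over `K(t)`. -/

section FiniteOverAdjoin

variable {K F : Type*} [Field K] [Field F] [Algebra K F] [Algebra (RatFunc K) F]
  [IsScalarTower K (RatFunc K) F] [FunctionField K F]

theorem essFiniteType_of_functionField : Algebra.EssFiniteType K F := by
  have : Algebra.EssFiniteType (Polynomial K) (RatFunc K) :=
    Algebra.EssFiniteType.of_isLocalization _ (nonZeroDivisors (Polynomial K))
  have : Algebra.EssFiniteType K (RatFunc K) :=
    Algebra.EssFiniteType.comp K (Polynomial K) (RatFunc K)
  exact Algebra.EssFiniteType.comp K (RatFunc K) F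

theorem trdeg_functionField_eq_one : Algebra.trdeg K F = 1 := by
  have h1 : IsTranscendenceBasis K fun _ : Unit => (Polynomial.X : Polynomial K) :=
    IsTranscendenceBasis.polynomial _ _
  have : Algebra.IsAlgebraic (Polynomial K) (RatFunc K) :=
    IsLocalization.isAlgebraic (RatFunc K) (nonZeroDivisors (Polynomial K))
  have h2 := (h1.algebraMap_comp (A := RatFunc K)).algebraMap_comp (A := F)
  have := h2.lift_cardinalMk_eq_trdeg
  simpa using this.symm

/-- In transcendence degree one, `t` alone is a transcendence basis; a finitely generated algebraic
extension is finite. -/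
theorem finiteDimensional_adjoin_simple {t : F} (ht : Transcendental K t) :
    FiniteDimensional (IntermediateField.adjoin K {t}) F := by
  have h : AlgebraicIndependent K (fun _ : Unit => t) := by
    rw [algebraicIndependent_unique_type_iff]; exact ht
  have hb : IsTranscendenceBasis K (fun _ : Unit => t) :=
    h.isTranscendenceBasis_of_lift_trdeg_le_of_finite
      (by rw [trdeg_functionField_eq_one]; simp)
  have ha := hb.isAlgebraic_field
  have hr : Set.range (fun _ : Unit => t) = {t} := by ext; simp [eq_comm]
  rw [hr] at ha
  have := essFiniteType_of_functionField (K := K) (F := F)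
  have := Algebra.EssFiniteType.of_comp K (IntermediateField.adjoin K {t}) F
  exact Algebra.finite_of_essFiniteType_of_isAlgebraic

/-- Any `d + 1` elements of `F`, where `d = [F : K(t)]`, satisfy a linear relation with
coefficients in `K[t]`. -/
theorem exists_polynomial_relation {t : F} (ht : Transcendental K t) {ι : Type*} [Fintype ι]
    (e : ι → F) (hι : Module.finrank (IntermediateField.adjoin K {t}) F < Fintype.card ι) :
    ∃ p : ι → Polynomial K, p ≠ 0 ∧ ∑ i, Polynomial.aeval t (p i) * e i = 0 := by
  classical
  have := finiteDimensional_adjoin_simple ht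
  have hdep : ¬ LinearIndependent (IntermediateField.adjoin K {t}) e := fun h =>
    absurd h.fintype_card_le_finrank (by lia)
  rw [Fintype.not_linearIndependent_iff] at hdep
  obtain ⟨c, hc, i₀, hi₀⟩ := hdep
  have hrs : ∀ i, ∃ r s : Polynomial K, (c i : F) = Polynomial.aeval t r / Polynomial.aeval t s :=
    fun i => IntermediateField.mem_adjoin_simple_iff K _ |>.1 (c i).2
  choose r q hrq using hrs
  have hinj : ∀ p : Polynomial K, Polynomial.aeval t p = 0 → p = 0 := by
    intro p hp
    exact (transcendental_iff.1 ht) p hp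
  -- A denominator `q i` may be zero, in which case the quotient is `0` by convention; it is
  -- replaced by `0 / 1` before denominators are cleared.
  let s : ι → Polynomial K := fun i => if q i = 0 then 1 else q i
  have hs : ∀ i, Polynomial.aeval t (s i) ≠ 0 := by
    intro i h
    have := hinj _ h
    by_cases hq : q i = 0 <;> simp [s, hq] at this
  let r' : ι → Polynomial K := fun i => if q i = 0 then 0 else r i
  have hrs : ∀ i, Polynomial.aeval t (s i) * (c i : F) = Polynomial.aeval t (r' i) := by
    intro i
    by_cases hq : q i = 0
    · rw [hrq i]; simp [s, r', hq]
    · have := hs i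
      rw [hrq i]
      simp only [s, r', hq, if_false] at this ⊢
      field_simp
  refine ⟨fun i => (∏ j ∈ Finset.univ.erase i, s j) * r' i, ?_, ?_⟩
  · intro h
    have h1 := congrFun h i₀
    have h2 := congrArg (Polynomial.aeval t) h1
    simp only [map_mul, map_prod, Pi.zero_apply, map_zero, ← hrs] at h2
    rcases mul_eq_zero.1 h2 with h3 | h3
    · obtain ⟨j, -, hj⟩ := Finset.prod_eq_zero_iff.1 h3
      exact hs j hj
    · rcases mul_eq_zero.1 h3 with h4 | h4
      · exact hs _ h4
      · exact hi₀ (by exact_mod_cast h4)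
  · have : ∀ i, Polynomial.aeval t ((∏ j ∈ Finset.univ.erase i, s j) * r' i) * e i =
        (∏ j, Polynomial.aeval t (s j)) * (c i • e i) := by
      intro i
      rw [map_mul, map_prod, ← hrs, ← Finset.mul_prod_erase _ _ (Finset.mem_univ i),
        IntermediateField.smul_def, smul_eq_mul]
      ring
    simp only [this, ← Finset.mul_sum, hc, mul_zero]

end FiniteOverAdjoin

end HaltonFF
end

noncomputable section
namespace HaltonFF

/-! ### Places: finite residue degree and discreteness. -/

namespace Place

variable {K F : Type*} [Field K] [Field F] [Algebra K F]

instance isScalarTower_ring (P : Place K F) : IsScalarTower K P.ring F :=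
  .of_algebraMap_eq fun _ => rfl

theorem exists_ne_zero_mem_maximalIdeal (P : Place K F) :
    ∃ t : P.ring, t ≠ 0 ∧ t ∈ IsLocalRing.maximalIdeal P.ring := by
  have h : ∃ f : F, f ∉ P.ring := by
    by_contra! h
    exact P.ne_top (SetLike.ext fun f => ⟨fun _ => trivial, fun _ => h f⟩)
  obtain ⟨f, hf⟩ := h
  have hf0 : f ≠ 0 := fun h => hf (h ▸ P.ring.zero_mem)
  have hf' : f⁻¹ ∈ P.ring := (P.ring.mem_or_inv_mem f).resolve_left hf
  refine ⟨⟨f⁻¹, hf'⟩, fun h => inv_ne_zero hf0 (congrArg Subtype.val h), ?_⟩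
  rw [IsLocalRing.mem_maximalIdeal, mem_nonunits_iff]
  rintro ⟨u, hu⟩
  apply hf
  have h1 : ((u⁻¹ : P.ringˣ) : P.ring) * (u : P.ring) = 1 := u.inv_mul
  rw [hu] at h1
  have h2 : (((u⁻¹ : P.ringˣ) : P.ring) : F) * f⁻¹ = 1 := congrArg Subtype.val h1
  have h3 : f = (((u⁻¹ : P.ringˣ) : P.ring) : F) := by
    field_simp at h2; exact h2.symm
  rw [h3]
  exact Subtype.property _

/-- An algebraic element would be a nonzero constant, hence a unit. -/
theorem transcendental_of_mem_maximalIdeal (hK : algebraicClosure K F = ⊥) (P : Place K F)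
    {t : P.ring} (ht0 : t ≠ 0) (ht : t ∈ IsLocalRing.maximalIdeal P.ring) :
    Transcendental K (t : F) := by
  intro halg
  have h : (t : F) ∈ algebraicClosure K F := mem_algebraicClosure_iff.2 halg
  rw [hK, IntermediateField.mem_bot] at h
  obtain ⟨c, hc⟩ := h
  have hc' : algebraMap K P.ring c = t := Subtype.ext hc
  have hc0 : c ≠ 0 := by
    rintro rfl
    exact ht0 (by rw [← hc', map_zero])
  exact (IsLocalRing.mem_maximalIdeal _).1 ht (hc' ▸ (IsUnit.mk0 c hc0).map (algebraMap K P.ring))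

variable [Algebra (RatFunc K) F] [IsScalarTower K (RatFunc K) F] [FunctionField K F]

/-- The dimension is at most `[F : K(t)]`: lifts of more elements satisfy a relation over `K[t]`.
Once the largest common power of `t` is cancelled, its constant terms give a nontrivial relation
modulo `t`. -/
theorem finite_quotient_span (P : Place K F) {t : P.ring} (ht : Transcendental K (t : F)) :
    Module.Finite K (P.ring ⧸ Ideal.span {t}) := by
  classical
  have ht0 : (t : F) ≠ 0 := fun h => ht (h ▸ isAlgebraic_zero)
  have hrank : Module.rank K (P.ring ⧸ Ideal.span {t}) ≤
      (Module.finrank (IntermediateField.adjoin K {(t : F)}) F : ℕ) := by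
    refine rank_le fun s hs => ?_
    by_contra! hcard
    choose e he using fun i : s => Ideal.Quotient.mk_surjective (I := Ideal.span {t}) i.1
    obtain ⟨p, hp0, hp⟩ := exists_polynomial_relation ht (fun i => (e i : F))
      (by simpa using hcard)
    obtain ⟨i₀, hi₀⟩ : ∃ i, p i ≠ 0 := by
      by_contra! h; exact hp0 (funext h)
    have hex : ∃ k, ¬ ∀ i, (Polynomial.X : Polynomial K) ^ k ∣ p i := by
      refine ⟨(p i₀).natDegree + 1, fun h => ?_⟩
      have := Polynomial.natDegree_le_of_dvd (h i₀) hi₀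
      simp at this
    obtain ⟨k, hk⟩ : ∃ k, Nat.find hex = k + 1 := by
      refine Nat.exists_eq_succ_of_ne_zero fun h => ?_
      exact (h ▸ Nat.find_spec hex) (fun i => by simp)
    have hdvd : ∀ i, (Polynomial.X : Polynomial K) ^ k ∣ p i :=
      not_not.1 (Nat.find_min hex (by lia))
    have hnd : ¬ ∀ i, (Polynomial.X : Polynomial K) ^ (k + 1) ∣ p i := hk ▸ Nat.find_spec hex
    choose q hq using hdvd
    have hsum : ∑ i, Polynomial.aeval t (q i) * e i = 0 := by
      apply Subtype.val_injective
      have h1 : (t : F) ^ k * ∑ i, Polynomial.aeval (t : F) (q i) * (e i : F) = 0 := by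
        rw [← hp, Finset.mul_sum]
        refine Finset.sum_congr rfl fun i _ => ?_
        rw [hq i, map_mul, map_pow, Polynomial.aeval_X]; ring
      have h2 := (mul_eq_zero.1 h1).resolve_left (pow_ne_zero _ ht0)
      have h3 : algebraMap P.ring F (∑ i, Polynomial.aeval t (q i) * e i) = 0 := by
        rw [map_sum, ← h2]
        refine Finset.sum_congr rfl fun i _ => ?_
        rw [map_mul, ← Polynomial.aeval_algebraMap_apply]; rfl
      exact h3
    have hzero : ∑ i : s, (q i).coeff 0 • (i : P.ring ⧸ Ideal.span {t}) = 0 := by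
      have h4 : Ideal.Quotient.mk (Ideal.span {t}) (∑ i, Polynomial.aeval t (q i) * e i) = 0 := by
        rw [hsum, map_zero]
      rw [map_sum] at h4
      rw [← h4]
      refine Finset.sum_congr rfl fun i _ => ?_
      rw [map_mul, he i, Algebra.smul_def]
      congr 1
      have h5 : Polynomial.aeval t (q i) =
          t * Polynomial.aeval t (q i).divX + algebraMap K P.ring ((q i).coeff 0) := by
        have h6 := congrArg (Polynomial.aeval t) (Polynomial.X_mul_divX_add (q i))
        rw [map_add, map_mul, Polynomial.aeval_X, Polynomial.aeval_C] at h6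
        exact h6.symm
      rw [h5, map_add, map_mul, Ideal.Quotient.eq_zero_iff_mem.2 (Ideal.mem_span_singleton_self t),
        zero_mul, zero_add]
      rfl
    apply hnd
    intro i
    have h6 := Fintype.linearIndependent_iff.1 hs _ hzero i
    rw [hq i, pow_succ]
    exact mul_dvd_mul_left _ (Polynomial.X_dvd_iff.2 h6)
  exact Module.rank_lt_aleph0_iff.1 (hrank.trans_lt Cardinal.natCast_lt_aleph0)

/-- The content is that the residue field is finite over `K`, since `Module.finrank` is `0` in
infinite dimension. -/
theorem deg_pos (hK : algebraicClosure K F = ⊥) (P : Place K F) : 0 < P.deg := by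
  obtain ⟨t, ht0, ht⟩ := P.exists_ne_zero_mem_maximalIdeal
  have := P.finite_quotient_span (P.transcendental_of_mem_maximalIdeal hK ht0 ht)
  have hle : Ideal.span {t} ≤ IsLocalRing.maximalIdeal P.ring := by
    rwa [Ideal.span_singleton_le_iff_mem]
  have : Module.Finite K (IsLocalRing.ResidueField P.ring) :=
    Module.Finite.of_surjective (Ideal.Quotient.factorₐ K hle).toLinearMap
      (Ideal.Quotient.factor_surjective hle)
  exact Module.finrank_pos

/-- The quotient by `f` is Artinian, so some power of the maximal ideal lies in `(f)` and its square
in `(f ^ 2)`. An `f` in all powers would be a multiple of `f ^ 2`, hence a unit. This makes the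
supremum in `ordNat` one of a bounded set. -/
theorem exists_notMem_maximalIdeal_pow (hK : algebraicClosure K F = ⊥) (P : Place K F)
    {f : P.ring} (hf : f ≠ 0) :
    ∃ n, f ∉ IsLocalRing.maximalIdeal P.ring ^ n := by
  by_contra! h
  have hfm : f ∈ IsLocalRing.maximalIdeal P.ring := by simpa using h 1
  have := P.finite_quotient_span (P.transcendental_of_mem_maximalIdeal hK hf hfm)
  have : IsArtinianRing (P.ring ⧸ Ideal.span {f}) := IsArtinianRing.of_finite K _
  obtain ⟨N, hN⟩ : ∃ N, IsLocalRing.maximalIdeal P.ring ^ N ≤ Ideal.span {f} := by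
    obtain ⟨N, hN⟩ := IsArtinianRing.isNilpotent_jacobson_bot (R := P.ring ⧸ Ideal.span {f})
    refine ⟨N, ?_⟩
    have h1 : (IsLocalRing.maximalIdeal P.ring).map (Ideal.Quotient.mk (Ideal.span {f})) ≤
        Ideal.jacobson ⊥ := by
      rw [Ideal.map_le_iff_le_comap]
      intro x hx
      rw [Ideal.mem_comap, Ideal.mem_jacobson_bot]
      intro y
      obtain ⟨y, rfl⟩ := Ideal.Quotient.mk_surjective y
      rw [← map_mul, ← map_one (Ideal.Quotient.mk (Ideal.span {f})), ← map_add]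
      refine IsUnit.map _ ?_
      by_contra hu
      have hu' : x * y + 1 ∈ IsLocalRing.maximalIdeal P.ring := hu
      have := Ideal.sub_mem _ hu' (Ideal.mul_mem_right y _ hx)
      rw [add_sub_cancel_left] at this
      exact (Ideal.ne_top_iff_one _).1 (IsLocalRing.maximalIdeal.isMaximal P.ring).ne_top this
    have h2 := Ideal.pow_right_mono h1 N
    rw [hN, ← Ideal.map_pow, Ideal.map_le_iff_le_comap] at h2
    intro x hx
    have := h2 hx
    rw [Ideal.mem_comap] at this
    exact Ideal.Quotient.eq_zero_iff_mem.1 (by simpa using this)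
  have h3 := h (N * 2)
  rw [pow_mul] at h3
  have h4 := Ideal.pow_right_mono hN 2 h3
  rw [Ideal.span_singleton_pow, Ideal.mem_span_singleton] at h4
  obtain ⟨g, hg⟩ := h4
  have h5 : f * g = 1 := by
    have : f * (f * g) = f * 1 := by rw [mul_one, ← mul_assoc, ← sq, ← hg]
    exact mul_left_cancel₀ hf this
  exact (IsLocalRing.mem_maximalIdeal _).1 hfm (IsUnit.of_mul_eq_one _ h5)

theorem le_ordNat_iff (hK : algebraicClosure K F = ⊥) (P : Place K F)
    {f : P.ring} (hf : f ≠ 0) (n : ℕ) :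
    n ≤ P.ordNat (f : F) ↔ f ∈ IsLocalRing.maximalIdeal P.ring ^ n := by
  have hset : {n : ℕ | ∃ a : P.ring, a ∈ IsLocalRing.maximalIdeal P.ring ^ n ∧ (a : F) = f} =
      {n | f ∈ IsLocalRing.maximalIdeal P.ring ^ n} := by
    ext n
    constructor
    · rintro ⟨a, ha, hfa⟩
      rwa [Set.mem_ofPred_eq, ← Subtype.ext hfa]
    · exact fun h => ⟨f, h, rfl⟩
  rw [ordNat, hset]
  obtain ⟨N, hN⟩ := P.exists_notMem_maximalIdeal_pow hK hf
  have hbdd : BddAbove {n | f ∈ IsLocalRing.maximalIdeal P.ring ^ n} := by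
    refine ⟨N, fun n hn => ?_⟩
    by_contra! hlt
    exact hN (Ideal.pow_le_pow_right hlt.le hn)
  constructor
  · intro h
    have := Nat.sSup_mem ⟨0, by simp⟩ hbdd
    exact Ideal.pow_le_pow_right h this
  · exact fun h => le_csSup hbdd h

theorem natCast_le_ord_iff (hK : algebraicClosure K F = ⊥) (P : Place K F)
    {f : F} (hf : f ≠ 0) (n : ℕ) :
    (n : ℤ) ≤ P.ord f ↔
      ∃ h : f ∈ P.ring, (⟨f, h⟩ : P.ring) ∈ IsLocalRing.maximalIdeal P.ring ^ n := by
  by_cases h : f ∈ P.ring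
  · have := P.le_ordNat_iff hK (f := ⟨f, h⟩) (fun h0 => hf (congrArg Subtype.val h0)) n
    simp only [ord, h, if_true, Nat.cast_le, this, exists_true_left]
  · have hi : f⁻¹ ∈ P.ring := (P.ring.mem_or_inv_mem f).resolve_left h
    have h1 : 1 ≤ P.ordNat f⁻¹ := by
      refine (P.le_ordNat_iff hK (f := ⟨f⁻¹, hi⟩)
        (fun h0 => inv_ne_zero hf (congrArg Subtype.val h0)) 1).2 ?_
      rw [pow_one, IsLocalRing.mem_maximalIdeal, mem_nonunits_iff]
      rintro ⟨u, hu⟩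
      apply h
      have h2 : (((u⁻¹ : P.ringˣ) : P.ring) : F) * ((u : P.ring) : F) = 1 :=
        congrArg Subtype.val u.inv_mul
      rw [hu] at h2
      have h3 : f = (((u⁻¹ : P.ringˣ) : P.ring) : F) := by
        field_simp at h2; exact h2.symm
      rw [h3]
      exact Subtype.property _
    simp only [ord, h, if_false, IsEmpty.exists_iff, iff_false]
    lia

end Place

end HaltonFF
end

noncomputable section
namespace HaltonFF

/-! ### Chain ideals in the holomorphy ring and block coordinates. -/

section Chains

variable {K F : Type*} [Field K] [Field F] [Algebra K F]

theorem coe_mem_ring {Pinf P : Place K F} (h : P ≠ Pinf) (f : holomorphyRing Pinf) :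
    (f : F) ∈ P.ring := f.2 P h

/-- The inclusion of the holomorphy ring into the valuation ring of a place `P ≠ Pinf`. -/
def toPlaceRing {Pinf P : Place K F} (h : P ≠ Pinf) : holomorphyRing Pinf →+* P.ring :=
  (holomorphyRing Pinf).val.toRingHom.codRestrict P.ring.toSubring (coe_mem_ring h)

/-- The prime ideal of the holomorphy ring cut out by a place `P ≠ Pinf`. -/
def centerIdeal {Pinf P : Place K F} (h : P ≠ Pinf) : Ideal (holomorphyRing Pinf) :=
  (IsLocalRing.maximalIdeal P.ring).comap (toPlaceRing h)

instance centerIdeal_isPrime {Pinf P : Place K F} (h : P ≠ Pinf) : (centerIdeal h).IsPrime :=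
  Ideal.comap_isPrime _ _

theorem mem_centerIdeal_iff {Pinf P : Place K F} (h : P ≠ Pinf) (f : holomorphyRing Pinf) :
    f ∈ centerIdeal h ↔ P.ring.valuation (f : F) < 1 :=
  P.ring.valuation_lt_one_iff (toPlaceRing h f)

open scoped Classical in
/-- The multiplicity of `P` in `Q 0 + ⋯ + Q (j - 1)`. -/
def chainMult (Q : ℕ → Place K F) (j : ℕ) (P : Place K F) : ℕ :=
  ∑ k ∈ Finset.range j, if Q k = P then 1 else 0

theorem chainDivisor_apply (Q : ℕ → Place K F) (j : ℕ) (P : Place K F) :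
    chainDivisor Q j P = (chainMult Q j P : ℤ) := by
  classical
  simp [chainDivisor, chainMult, Finsupp.finsetSum_apply, Finsupp.single_apply]

theorem chainMult_mono (Q : ℕ → Place K F) (P : Place K F) : Monotone fun j => chainMult Q j P :=
  fun _ _ hij => Finset.sum_le_sum_of_subset (Finset.range_mono hij)

theorem chainMult_eq_zero {Q : ℕ → Place K F} {P : Place K F} (h : ∀ k, Q k ≠ P) (j : ℕ) :
    chainMult Q j P = 0 := by
  simp [chainMult, h]

/-- The ideal of the functions in the holomorphy ring whose divisor of zeros is at least
`Q 0 + ⋯ + Q (j - 1)`. -/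
def chainIdeal (Pinf : Place K F) (Q : ℕ → Place K F) (j : ℕ) : Ideal (holomorphyRing Pinf) :=
  ⨅ (P : Place K F) (h : P ≠ Pinf),
    (IsLocalRing.maximalIdeal P.ring ^ chainMult Q j P).comap (toPlaceRing h)

theorem mem_chainIdeal {Pinf : Place K F} {Q : ℕ → Place K F} {j : ℕ} {f : holomorphyRing Pinf} :
    f ∈ chainIdeal Pinf Q j ↔ ∀ (P : Place K F) (h : P ≠ Pinf),
      toPlaceRing h f ∈ IsLocalRing.maximalIdeal P.ring ^ chainMult Q j P := by
  simp [chainIdeal]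

theorem chainIdeal_antitone (Pinf : Place K F) (Q : ℕ → Place K F) :
    Antitone (chainIdeal Pinf Q) := fun _ _ hij _ hf =>
  mem_chainIdeal.2 fun P h => Ideal.pow_le_pow_right (chainMult_mono Q P hij) (mem_chainIdeal.1 hf P h)

theorem chainIdeal_mul_le (Pinf : Place K F) {Q : ℕ → Place K F} (hQ : ∀ k, Q k ≠ Pinf) (j : ℕ) :
    chainIdeal Pinf Q j * centerIdeal (hQ j) ≤ chainIdeal Pinf Q (j + 1) := by
  classical
  rw [Ideal.mul_le]
  intro f hf g hg
  rw [mem_chainIdeal] at hf ⊢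
  intro P h
  have hm : chainMult Q (j + 1) P = chainMult Q j P + if Q j = P then 1 else 0 :=
    Finset.sum_range_succ _ _
  rw [hm, map_mul]
  split_ifs with hP
  · subst hP
    rw [pow_succ]
    exact Ideal.mul_mem_mul (hf _ h) hg
  · exact Ideal.mul_mem_right _ _ (hf P h)

theorem chainIdeal_le_centerIdeal (Pinf : Place K F) {Q : ℕ → Place K F} (hQ : ∀ k, Q k ≠ Pinf)
    (j : ℕ) : chainIdeal Pinf Q (j + 1) ≤ centerIdeal (hQ j) := by
  classical
  intro f hf
  have h1 := mem_chainIdeal.1 hf (Q j) (hQ j)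
  have h2 : chainMult Q (j + 1) (Q j) ≠ 0 := by
    simpa [chainMult] using ⟨j, le_rfl, rfl⟩
  have h3 := Ideal.pow_le_self h2 h1
  exact h3

/-- The chain ideal contains the product of the centers of its places, and a prime containing a
product contains a factor. -/
theorem exists_centerIdeal_le_of_chainIdeal_le {Pinf : Place K F} {Q : ℕ → Place K F}
    (hQ : ∀ k, Q k ≠ Pinf) {M : Ideal (holomorphyRing Pinf)} (hM : M.IsPrime) {j : ℕ}
    (h : chainIdeal Pinf Q j ≤ M) : ∃ k, centerIdeal (hQ k) ≤ M := by
  induction j with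
  | zero =>
    refine absurd (hM.ne_top) (not_not.2 ?_)
    rw [Ideal.eq_top_iff_one]
    exact h (mem_chainIdeal.2 fun P _ => by simp [chainMult])
  | succ j ih =>
    rcases hM.mul_le.1 ((chainIdeal_mul_le Pinf hQ j).trans h) with h1 | h1
    · exact ih h1
    · exact ⟨j, h1⟩

theorem smul_mem_ideal {Pinf : Place K F} (I : Ideal (holomorphyRing Pinf)) (c : K)
    {f : holomorphyRing Pinf} (hf : f ∈ I) : c • f ∈ I := by
  rw [Algebra.smul_def]; exact I.mul_mem_left _ hf

variable [Algebra (RatFunc K) F] [IsScalarTower K (RatFunc K) F] [FunctionField K F]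

theorem mem_chainIdeal_of_coe_mem_rrSpace (hK : algebraicClosure K F = ⊥) {Pinf : Place K F}
    {Q : ℕ → Place K F} {i j : ℕ} {f : holomorphyRing Pinf}
    (hf : (f : F) ∈ rrSpace (poleDivisor Pinf Q i - chainDivisor Q j)) :
    f ∈ chainIdeal Pinf Q j := by
  classical
  rcases hf with ⟨hf0, hf⟩ | hf
  · refine mem_chainIdeal.2 fun P h => ?_
    have h1 := hf P
    rw [Finsupp.sub_apply, poleDivisor, Finsupp.single_apply, if_neg (Ne.symm h),
      chainDivisor_apply] at h1
    obtain ⟨_, h2⟩ := (P.natCast_le_ord_iff hK hf0 (chainMult Q j P)).1 (by lia)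
    exact h2
  · have : f = 0 := Subtype.ext hf
    rw [this]; exact zero_mem _

theorem coe_mem_rrSpace_of_mem_chainIdeal (hK : algebraicClosure K F = ⊥) {Pinf : Place K F}
    {Q : ℕ → Place K F} (hQ : ∀ k, Q k ≠ Pinf) {i j j' : ℕ} {f : holomorphyRing Pinf}
    (hf : (f : F) ∈ rrSpace (poleDivisor Pinf Q i - chainDivisor Q j))
    (hf' : f ∈ chainIdeal Pinf Q j') :
    (f : F) ∈ rrSpace (poleDivisor Pinf Q i - chainDivisor Q j') := by
  classical
  rcases hf with ⟨hf0, hf⟩ | hf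
  · refine Or.inl ⟨hf0, fun P => ?_⟩
    by_cases h : P = Pinf
    · have h1 := hf P
      rw [Finsupp.sub_apply, chainDivisor_apply, chainMult_eq_zero fun k => h ▸ hQ k] at h1 ⊢
      exact h1
    · have h1 := (P.natCast_le_ord_iff hK hf0 (chainMult Q j' P)).2
        ⟨coe_mem_ring h f, mem_chainIdeal.1 hf' P h⟩
      rw [Finsupp.sub_apply, poleDivisor, Finsupp.single_apply, if_neg (Ne.symm h),
        chainDivisor_apply]
      lia
  · exact Or.inr hf

theorem chainDegree_strictMono (hK : algebraicClosure K F = ⊥) (Q : ℕ → Place K F) :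
    StrictMono (chainDegree Q) :=
  strictMono_nat_of_lt_succ fun j => by
    simpa [chainDegree, Finset.sum_range_succ] using (Q j).deg_pos hK

theorem basis_mem_chainIdeal (hK : algebraicClosure K F = ⊥) {Pinf : Place K F}
    {Q : ℕ → Place K F} {w : ℕ → holomorphyRing Pinf}
    (hw : IsBlockSequence Pinf Q fun l => (w l : F)) {j l : ℕ} (hl : chainDegree Q j ≤ l) :
    w l ∈ chainIdeal Pinf Q j := by
  have hmono := chainDegree_strictMono hK Q
  have hex : ∃ k, l < chainDegree Q k := ⟨l + 1, hmono.le_apply⟩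
  obtain ⟨k, hk⟩ : ∃ k, Nat.find hex = k + 1 := by
    refine Nat.exists_eq_succ_of_ne_zero fun h => ?_
    have := h ▸ Nat.find_spec hex
    simp [chainDegree] at this
  have h1 : l < chainDegree Q (k + 1) := hk ▸ Nat.find_spec hex
  have h2 : chainDegree Q k ≤ l := not_lt.1 (Nat.find_min hex (by lia))
  have hjk : j ≤ k := by
    have := hmono.lt_iff_lt.1 (hl.trans_lt h1); lia
  refine chainIdeal_antitone Pinf Q hjk ?_
  obtain ⟨u, -, hb⟩ := hw k
  refine mem_chainIdeal_of_coe_mem_rrSpace (i := k) hK ?_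
  rw [← hb.2]
  refine Submodule.subset_span ⟨Sum.inl ⟨l - chainDegree Q k, ?_⟩, ?_⟩
  · have : chainDegree Q (k + 1) = chainDegree Q k + (Q k).deg := Finset.sum_range_succ _ _
    lia
  · simp [Nat.add_sub_cancel' h2]

theorem mem_chainIdeal_of_repr_eq_zero (hK : algebraicClosure K F = ⊥) {Pinf : Place K F}
    {Q : ℕ → Place K F} (w : Module.Basis ℕ K (holomorphyRing Pinf))
    (hw : IsBlockSequence Pinf Q fun l => (w l : F)) {j : ℕ} {f : holomorphyRing Pinf}
    (hf : ∀ l < chainDegree Q j, w.repr f l = 0) : f ∈ chainIdeal Pinf Q j := by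
  rw [← w.linearCombination_repr f, Finsupp.linearCombination_apply, Finsupp.sum]
  refine Ideal.sum_mem _ fun l hl => smul_mem_ideal _ _ (basis_mem_chainIdeal hK hw ?_)
  by_contra! h
  exact Finsupp.mem_support_iff.1 hl (hf l h)

/-- This converts the block construction into ideal theory. In the inductive step the part `g` of
`f` in the `j`-th block again lies in the next chain ideal, hence in the span of `u`. Block and `u`
are independent, so `g = 0`. -/
theorem mem_chainIdeal_iff_repr (hK : algebraicClosure K F = ⊥) {Pinf : Place K F}
    {Q : ℕ → Place K F} (hQ : ∀ k, Q k ≠ Pinf) (w : Module.Basis ℕ K (holomorphyRing Pinf))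
    (hw : IsBlockSequence Pinf Q fun l => (w l : F)) (j : ℕ) (f : holomorphyRing Pinf) :
    f ∈ chainIdeal Pinf Q j ↔ ∀ l < chainDegree Q j, w.repr f l = 0 := by
  classical
  refine ⟨fun hf => ?_, mem_chainIdeal_of_repr_eq_zero hK w hw⟩
  induction j with
  | zero => simp [chainDegree]
  | succ j ih =>
    have ih := ih (chainIdeal_antitone Pinf Q (Nat.le_succ j) hf)
    have hdeg : chainDegree Q (j + 1) = chainDegree Q j + (Q j).deg := Finset.sum_range_succ _ _
    set g : holomorphyRing Pinf :=
      ∑ μ : Fin (Q j).deg, w.repr f (chainDegree Q j + μ) • w (chainDegree Q j + μ) with hg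
    have hgrepr : ∀ l, chainDegree Q j ≤ l → l < chainDegree Q (j + 1) →
        w.repr g l = w.repr f l := by
      intro l h1 h2
      obtain ⟨μ, rfl⟩ := Nat.exists_eq_add_of_le h1
      rw [hg, map_sum, Finsupp.finsetSum_apply, Finset.sum_eq_single ⟨μ, by lia⟩]
      · simp
      · intro ν _ hν
        have : (ν : ℕ) ≠ μ := fun h => hν (Fin.ext h)
        simp [this]
      · simp
    have hgrepr' : ∀ l < chainDegree Q j, w.repr g l = 0 := by
      intro l hl
      rw [hg, map_sum, Finsupp.finsetSum_apply]
      refine Finset.sum_eq_zero fun μ _ => ?_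
      have : chainDegree Q j + (μ : ℕ) ≠ l := by lia
      simp [this]
    have hfg : f - g ∈ chainIdeal Pinf Q (j + 1) := by
      refine mem_chainIdeal_of_repr_eq_zero hK w hw fun l hl => ?_
      rw [map_sub, Finsupp.sub_apply, sub_eq_zero]
      rcases lt_or_ge l (chainDegree Q j) with h | h
      · rw [hgrepr' l h, ih l h]
      · rw [hgrepr l h hl]
    have hgI : g ∈ chainIdeal Pinf Q (j + 1) := by
      have := Ideal.sub_mem _ hf hfg
      rwa [sub_sub_cancel] at this
    obtain ⟨u, hu, hb⟩ := hw j
    have hgF : (g : F) = ∑ μ : Fin (Q j).deg,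
        w.repr f (chainDegree Q j + μ) • (w (chainDegree Q j + μ) : F) := by
      rw [hg]; push_cast; rfl
    have hgs : (g : F) ∈ Submodule.span K
        (Set.range fun μ : Fin (Q j).deg => (w (chainDegree Q j + μ) : F)) := by
      rw [hgF]
      exact Submodule.sum_mem _ fun μ _ => Submodule.smul_mem _ _ (Submodule.subset_span ⟨μ, rfl⟩)
    have hgrr : (g : F) ∈ rrSpace (poleDivisor Pinf Q j - chainDivisor Q j) := by
      rw [← hb.2]
      refine Submodule.span_mono ?_ hgs
      rintro _ ⟨μ, rfl⟩
      exact ⟨Sum.inl μ, rfl⟩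
    have hgu := coe_mem_rrSpace_of_mem_chainIdeal hK hQ hgrr hgI
    rw [← hu.2] at hgu
    have hli := linearIndependent_sum.1 hb.1
    have hg0 : (g : F) = 0 := Submodule.disjoint_def.1 hli.2.2 _ hgs hgu
    have hc := Fintype.linearIndependent_iff.1 hli.1
      (fun μ => w.repr f (chainDegree Q j + μ)) (by rw [← hg0, hgF]; rfl)
    intro l hl
    rcases lt_or_ge l (chainDegree Q j) with h | h
    · exact ih l h
    · obtain ⟨μ, rfl⟩ := Nat.exists_eq_add_of_le h
      exact hc ⟨μ, by lia⟩

end Chains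

end HaltonFF
end

noncomputable section
namespace HaltonFF

/-! ### Places are separated by their centers; simultaneous prescription of coordinates. -/

section Separation

variable {K F : Type*} [Field K] [Field F] [Algebra K F]

theorem coe_mem_holomorphyRing {Pinf : Place K F} {f : F} :
    f ∈ holomorphyRing Pinf ↔ ∀ P : Place K F, P ≠ Pinf → f ∈ P.ring := Iff.rfl

/-- The upper tails `B k = ∑ q (k + i) f ^ i` of a polynomial relation `∑ q i f ^ i = 0` over the
holomorphy ring lie in the holomorphy ring. -/
theorem tail_mem_holomorphyRing {Pinf : Place K F} {f : F} {q : ℕ → F} {B : ℕ → F} {d : ℕ}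
    (hq : ∀ k, q k ∈ holomorphyRing Pinf) (h0 : B 0 = 0) (hd : ∀ k, d < k → B k = 0)
    (hB : ∀ k, B k = q k + f * B (k + 1)) (k : ℕ) : B k ∈ holomorphyRing Pinf := by
  rw [coe_mem_holomorphyRing]
  intro P hP
  -- If `f` is regular at `P`, the recursion is run downwards from the vanishing tails; if `f⁻¹` is,
  -- it is run upwards from `B 0 = 0`. The value `f = 0` satisfies both and is treated apart where
  -- one has to divide.
  rcases P.ring.mem_or_inv_mem f with hf | hf
  · have key : ∀ n k, d < n + k → B k ∈ P.ring := by
      intro n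
      induction n with
      | zero => intro k hk; rw [hd k (by lia)]; exact P.ring.zero_mem
      | succ n ih =>
        intro k hk
        rw [hB k]
        exact P.ring.add_mem _ _ (hq k P hP) (P.ring.mul_mem _ _ hf (ih (k + 1) (by lia)))
    exact key (d + 1) k (by lia)
  · by_cases hf0 : f = 0
    · by_cases hk : k = 0
      · rw [hk, h0]; exact P.ring.zero_mem
      · rw [hB k, hf0, zero_mul, add_zero]; exact hq k P hP
    · induction k with
      | zero => rw [h0]; exact P.ring.zero_mem
      | succ k ih =>
        have : B (k + 1) = f⁻¹ * (B k - q k) := by rw [hB k]; field_simp; ring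
        rw [this]
        exact P.ring.mul_mem _ _ hf (P.ring.toSubring.sub_mem ih (hq k P hP))

/-- Otherwise the holomorphy ring would consist of constants and be one-dimensional, but it has a
basis indexed by `ℕ`. -/
theorem exists_transcendental (hK : algebraicClosure K F = ⊥) {Pinf : Place K F}
    (w : Module.Basis ℕ K (holomorphyRing Pinf)) :
    ∃ x : holomorphyRing Pinf, Transcendental K (x : F) := by
  by_contra! h
  have hconst : ∀ l, ∃ c : K, algebraMap K F c = (w l : F) := fun l => by
    have h1 : (w l : F) ∈ algebraicClosure K F :=
      mem_algebraicClosure_iff.2 (not_not.1 (h (w l)))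
    rwa [hK, IntermediateField.mem_bot] at h1
  obtain ⟨c, hc⟩ := hconst 0
  obtain ⟨c', hc'⟩ := hconst 1
  have h1 : c' • w 0 = c • w 1 := Subtype.ext (by
    push_cast
    rw [← hc, ← hc', Algebra.smul_def, Algebra.smul_def, mul_comm])
  have h2 := congrArg (fun v => w.repr v 1) h1
  have h3 : c = 0 := by simpa using h2.symm
  have h4 : w 0 = 0 := Subtype.ext (by rw [← hc, h3, map_zero]; rfl)
  exact w.ne_zero 0 h4

variable [Algebra (RatFunc K) F] [IsScalarTower K (RatFunc K) F] [FunctionField K F]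

/-- Every `f` is a root of a polynomial over `K[x]` whose coefficients generate the unit ideal. -/
theorem exists_primitive_relation {x : F} (hx : Transcendental K x) (f : F) :
    ∃ (d : ℕ) (q r : Fin (d + 1) → Polynomial K), ∑ i, r i * q i = 1 ∧
      ∑ i, Polynomial.aeval x (q i) * f ^ (i : ℕ) = 0 := by
  obtain ⟨p, hp0, hp⟩ := exists_polynomial_relation hx
    (fun i : Fin (Module.finrank (IntermediateField.adjoin K {x}) F + 1) => f ^ (i : ℕ)) (by simp)
  -- Dividing a relation by the gcd of its coefficients makes it primitive.
  have hprin := IsPrincipalIdealRing.principal (Ideal.span (Set.range p))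
  obtain ⟨g, hg⟩ := hprin
  have hg' : Ideal.span (Set.range p) = Ideal.span {g} := hg
  have hdvd : ∀ i, g ∣ p i := fun i => by
    rw [← Ideal.mem_span_singleton, ← hg']
    exact Ideal.subset_span ⟨i, rfl⟩
  choose q hq using hdvd
  have hg0 : g ≠ 0 := by
    rintro rfl
    exact hp0 (funext fun i => by rw [hq i, zero_mul]; rfl)
  obtain ⟨r, hr⟩ := Ideal.mem_span_range_iff_exists_fun.1
    (show g ∈ Ideal.span (Set.range p) from hg' ▸ Ideal.mem_span_singleton_self g)
  refine ⟨_, q, r, ?_, ?_⟩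
  · apply mul_left_cancel₀ hg0
    rw [mul_one, Finset.mul_sum]
    conv_rhs => rw [← hr]
    exact Finset.sum_congr rfl fun i _ => by rw [hq i]; ring
  · have h1 : Polynomial.aeval x g * ∑ i, Polynomial.aeval x (q i) * f ^ (i : ℕ) = 0 := by
      rw [← hp, Finset.mul_sum]
      exact Finset.sum_congr rfl fun i _ => by rw [hq i, map_mul]; ring
    exact (mul_eq_zero.1 h1).resolve_left fun h => hg0 (transcendental_iff.1 hx g h)

/-- Suppose `f` is regular at `P` but not at `P'`. The tails `B k` of a primitive relation for `f`
lie in the holomorphy ring, as does each `f * B (k + 1)`, so equality of centers transfers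
information about them between `P` and `P'`. At an index `m` where the coefficient is a unit at `P`,
either alternative for `B m` is contradictory. -/
theorem ring_le_of_centerIdeal_eq {Pinf P P' : Place K F} {x : holomorphyRing Pinf}
    (hx : Transcendental K (x : F)) (h : P ≠ Pinf) (h' : P' ≠ Pinf)
    (heq : centerIdeal h = centerIdeal h') : P.ring ≤ P'.ring := by
  have hv : ∀ g ∈ holomorphyRing Pinf, P.ring.valuation g < 1 ↔ P'.ring.valuation g < 1 :=
    fun g hg => by
      rw [← mem_centerIdeal_iff h ⟨g, hg⟩, ← mem_centerIdeal_iff h' ⟨g, hg⟩, heq]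
  intro f hf
  by_contra hf'
  obtain ⟨d, q, r, hr, hq⟩ := exists_primitive_relation hx f
  let q' : ℕ → F := fun i => if hi : i < d + 1 then Polynomial.aeval (x : F) (q ⟨i, hi⟩) else 0
  have hq'₁ : ∀ i : Fin (d + 1), q' i = Polynomial.aeval (x : F) (q i) := fun i => dif_pos i.2
  have hq'₀ : ∀ i, d < i → q' i = 0 := fun i hi => dif_neg (by lia)
  have hpoly : ∀ p : Polynomial K, Polynomial.aeval (x : F) p ∈ holomorphyRing Pinf := fun p => by
    rw [Subalgebra.aeval_coe]; exact Subtype.property _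
  have hq' : ∀ k, q' k ∈ holomorphyRing Pinf := fun k => by
    by_cases hk : k < d + 1
    · exact hq'₁ ⟨k, hk⟩ ▸ hpoly _
    · rw [hq'₀ k (by lia)]; exact zero_mem _
  let B : ℕ → F := fun k => ∑ i ∈ Finset.range (d + 1), q' (k + i) * f ^ i
  have hB0 : B 0 = 0 := by
    rw [← hq]
    simp only [B, zero_add]
    rw [Finset.sum_range]
    exact Finset.sum_congr rfl fun i _ => by rw [hq'₁]
  have hBd : ∀ k, d < k → B k = 0 := fun k hk => by
    refine Finset.sum_eq_zero fun i _ => ?_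
    rw [hq'₀ _ (by lia), zero_mul]
  have hB : ∀ k, B k = q' k + f * B (k + 1) := fun k => by
    have h1 : q' (k + 1 + d) = 0 := hq'₀ _ (by lia)
    simp only [B]
    rw [Finset.sum_range_succ', Finset.sum_range_succ _ d, h1, zero_mul]
    simp only [add_zero, pow_zero, mul_one, Finset.mul_sum]
    rw [add_comm]
    congr 1
    refine Finset.sum_congr rfl fun i _ => ?_
    rw [show k + (i + 1) = k + 1 + i by ring, pow_succ]; ring
  have hBmem := tail_mem_holomorphyRing hq' hB0 hBd hB
  obtain ⟨m, hm⟩ : ∃ m, ¬ P.ring.valuation (q' m) < 1 := by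
    by_contra! hall
    have h1 : (1 : holomorphyRing Pinf) ∈ centerIdeal h := by
      have : (1 : holomorphyRing Pinf) = ∑ i, Polynomial.aeval x (r i) * Polynomial.aeval x (q i) := by
        rw [← map_one (Polynomial.aeval (R := K) x), ← hr, map_sum]
        simp only [map_mul]
      rw [this]
      refine Ideal.sum_mem _ fun i _ => Ideal.mul_mem_left _ _ ?_
      rw [mem_centerIdeal_iff, ← Subalgebra.aeval_coe, ← hq'₁]
      exact hall i
    exact (Ideal.ne_top_iff_one _).1 (centerIdeal_isPrime h).ne_top h1
  have hη : f * B (m + 1) ∈ holomorphyRing Pinf := by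
    have : f * B (m + 1) = B m - q' m := by rw [hB m]; ring
    rw [this]; exact sub_mem (hBmem m) (hq' m)
  -- If `B m` vanishes at `P`, then `f * B (m + 1)` does not. But regularity of this product at the
  -- pole `P'` of `f` makes `B (m + 1)` vanish at `P'`, hence at `P`.
  by_cases hβ : P.ring.valuation (B m) < 1
  · have h1 : ¬ P.ring.valuation (f * B (m + 1)) < 1 := fun h1 => hm (by
      have : q' m = B m - f * B (m + 1) := by rw [hB m]; ring
      rw [this]
      exact lt_of_le_of_lt (Valuation.map_sub _ _ _) (max_lt hβ h1))
    have hfv : 1 < P'.ring.valuation f := by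
      by_contra! hle
      exact hf' ((P'.ring.valuation_le_one_iff f).1 hle)
    have h2 : P'.ring.valuation (B (m + 1)) < 1 := by
      have h3 : P'.ring.valuation (f * B (m + 1)) ≤ 1 :=
        (P'.ring.valuation_le_one_iff _).2 (hη P' h')
      rw [map_mul] at h3
      by_contra! h4
      exact absurd h3 (not_le.2 (one_lt_mul_of_lt_of_le' hfv h4))
    have h5 := (hv _ (hBmem (m + 1))).2 h2
    apply h1
    rw [map_mul]
    exact (mul_le_of_le_one_left' ((P.ring.valuation_le_one_iff f).2 hf)).trans_lt h5
  -- Otherwise `B m` is a unit at `P'` too, and regularity of `f * B m` at `P'` makes `f` regular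
  -- there.
  · have hβ' : P'.ring.valuation (B m) = 1 :=
      le_antisymm ((P'.ring.valuation_le_one_iff _).2 (hBmem m P' h'))
        (not_lt.1 fun hlt => hβ ((hv _ (hBmem m)).2 hlt))
    obtain ⟨m', rfl⟩ : ∃ m', m = m' + 1 := by
      refine Nat.exists_eq_succ_of_ne_zero fun h0 => ?_
      rw [h0, hB0, map_zero] at hβ'
      exact zero_ne_one hβ'
    have h1 : f * B (m' + 1) ∈ P'.ring := by
      have : f * B (m' + 1) = B m' - q' m' := by rw [hB m']; ring
      rw [this]; exact P'.ring.toSubring.sub_mem (hBmem m' P' h') (hq' m' P' h')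
    rw [← P'.ring.valuation_le_one_iff, map_mul, hβ', mul_one, P'.ring.valuation_le_one_iff] at h1
    exact hf' h1

theorem place_eq_of_centerIdeal_eq {Pinf P P' : Place K F} {x : holomorphyRing Pinf}
    (hx : Transcendental K (x : F)) (h : P ≠ Pinf) (h' : P' ≠ Pinf)
    (heq : centerIdeal h = centerIdeal h') : P = P' := by
  have hring : P.ring = P'.ring :=
    le_antisymm (ring_le_of_centerIdeal_eq hx h h' heq) (ring_le_of_centerIdeal_eq hx h' h heq.symm)
  cases P; cases P'
  simpa using hring

variable [Finite K]

/-- Modulo the chain ideal a function is determined by its first `chainDegree Q j` coordinates,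
which take finitely many values. -/
theorem finite_quotient_chainIdeal (hK : algebraicClosure K F = ⊥) {Pinf : Place K F}
    {Q : ℕ → Place K F} (w : Module.Basis ℕ K (holomorphyRing Pinf))
    (hw : IsBlockSequence Pinf Q fun l => (w l : F)) {j : ℕ} {I : Ideal (holomorphyRing Pinf)}
    (hI : chainIdeal Pinf Q j ≤ I) : Finite (holomorphyRing Pinf ⧸ I) := by
  refine Finite.of_surjective (α := Fin (chainDegree Q j) → K)
    (fun c => Ideal.Quotient.mk I (∑ l, c l • w l)) fun f => ?_
  obtain ⟨f, rfl⟩ := Ideal.Quotient.mk_surjective f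
  refine ⟨fun l => w.repr f l, ?_⟩
  rw [Ideal.Quotient.eq]
  refine hI (mem_chainIdeal_of_repr_eq_zero hK w hw fun l hl => ?_)
  rw [map_sub, Finsupp.sub_apply, map_sum, Finsupp.finsetSum_apply,
    Finset.sum_eq_single ⟨l, hl⟩]
  · simp
  · intro ν _ hν
    have : (ν : ℕ) ≠ l := fun h => hν (Fin.ext h)
    simp [this]
  · simp

theorem centerIdeal_isMaximal (hK : algebraicClosure K F = ⊥) {Pinf : Place K F}
    {Q : ℕ → Place K F} (hQ : ∀ k, Q k ≠ Pinf) (w : Module.Basis ℕ K (holomorphyRing Pinf))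
    (hw : IsBlockSequence Pinf Q fun l => (w l : F)) (j : ℕ) : (centerIdeal (hQ j)).IsMaximal := by
  have := finite_quotient_chainIdeal hK w hw (chainIdeal_le_centerIdeal Pinf hQ j)
  exact Ideal.Quotient.maximal_of_isField _ (Finite.isField_of_domain _)

/-- Any finitely many coordinates with respect to several block bases belonging to disjoint
chains of places can be prescribed simultaneously. -/
theorem exists_repr_eq (hK : algebraicClosure K F = ⊥) {Pinf : Place K F} {ι : Type*} [Finite ι]
    {Q : ι → ℕ → Place K F} (hQ : ∀ i k, Q i k ≠ Pinf)
    (hdisj : ∀ i i', i ≠ i' → ∀ k k', Q i k ≠ Q i' k')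
    (w : ι → Module.Basis ℕ K (holomorphyRing Pinf))
    (hw : ∀ i, IsBlockSequence Pinf (Q i) fun l => (w i l : F)) (m : ℕ) (e : ι → ℕ → K) :
    ∃ f : holomorphyRing Pinf, ∀ i, ∀ l < m, (w i).repr f l = e i l := by
  -- A maximal ideal above two chain ideals would be the center of a place from each of two disjoint
  -- chains.
  have hcop : Pairwise (Function.onFun IsCoprime fun i => chainIdeal Pinf (Q i) m) := by
    intro i i' hii'
    rw [Function.onFun, Ideal.isCoprime_iff_sup_eq]
    by_contra hne
    obtain ⟨M, hM, hle⟩ := Ideal.exists_le_maximal _ hne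
    obtain ⟨k, hk⟩ := exists_centerIdeal_le_of_chainIdeal_le (hQ i) hM.isPrime
      (le_sup_left.trans hle)
    obtain ⟨k', hk'⟩ := exists_centerIdeal_le_of_chainIdeal_le (hQ i') hM.isPrime
      (le_sup_right.trans hle)
    have h1 := (centerIdeal_isMaximal hK (hQ i) (w i) (hw i) k).eq_of_le hM.ne_top hk
    have h2 := (centerIdeal_isMaximal hK (hQ i') (w i') (hw i') k').eq_of_le hM.ne_top hk'
    obtain ⟨x, hx⟩ := exists_transcendental hK (w i)
    exact hdisj i i' hii' k k' (place_eq_of_centerIdeal_eq hx _ _ (h1.trans h2.symm))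
  obtain ⟨f, hf⟩ := Ideal.exists_forall_sub_mem_ideal hcop
    fun i => ∑ l : Fin m, e i l • w i l
  refine ⟨f, fun i l hl => ?_⟩
  -- Degrees are positive, so the first `m` places of a chain control at least `m` coordinates.
  have h1 := (mem_chainIdeal_iff_repr hK (hQ i) (w i) (hw i) m _).1 (hf i) l
    (hl.trans_le (chainDegree_strictMono hK (Q i)).le_apply)
  rw [map_sub, Finsupp.sub_apply, sub_eq_zero, map_sum, Finsupp.finsetSum_apply,
    Finset.sum_eq_single ⟨l, hl⟩] at h1
  · simpa using h1
  · intro ν _ hν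
    have : (ν : ℕ) ≠ l := fun h => hν (Fin.ext h)
    simp [this]
  · simp

end Separation

end HaltonFF
end

noncomputable section
namespace HaltonFF

/-! ### Numerical versus lexicographic comparison of digit expansions. -/

section Digits

variable {b : ℕ}

theorem ofDigits_lt_one {a : ℕ → Fin b} {k : ℕ} (hb : 1 < b) (hk : (a k : ℕ) ≠ b - 1) :
    Real.ofDigits a < 1 := by
  rw [← Real.ofDigits_const_last_eq_one' hb]
  refine Summable.tsum_lt_tsum (i := k) (fun i => ?_) ?_ Real.summable_ofDigitsTerm
    Real.summable_ofDigitsTerm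
  · have : (a i : ℕ) ≤ b - 1 := by lia
    unfold Real.ofDigitsTerm
    gcongr
  · have : (a k : ℕ) < b - 1 := by lia
    unfold Real.ofDigitsTerm
    have : 0 < b := by lia
    gcongr

/-- Comparison of real numbers through the first place where their digits differ. -/
theorem ofDigits_lt_of_lex {a g : ℕ → Fin b} (hb : 1 < b) {k k' : ℕ}
    (hag : ∀ i < k, a i = g i) (hk : a k < g k) (hkk' : k < k') (hk' : (a k' : ℕ) ≠ b - 1) :
    Real.ofDigits a < Real.ofDigits g := by
  have hb0 : 0 < b := by lia
  rw [Real.ofDigits_eq_sum_add_ofDigits a (k + 1), Real.ofDigits_eq_sum_add_ofDigits g (k + 1),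
    Finset.sum_range_succ, Finset.sum_range_succ]
  have h1 : ∑ i ∈ Finset.range k, Real.ofDigitsTerm a i =
      ∑ i ∈ Finset.range k, Real.ofDigitsTerm g i :=
    Finset.sum_congr rfl fun i hi => by
      simp [Real.ofDigitsTerm, hag i (Finset.mem_range.1 hi)]
  have h2 : Real.ofDigits (fun i => a (i + (k + 1))) < 1 :=
    ofDigits_lt_one hb (k := k' - (k + 1)) (by rwa [Nat.sub_add_cancel hkk'])
  have h3 : 0 ≤ Real.ofDigits (fun i => g (i + (k + 1))) := Real.ofDigits_nonneg _
  have h4 : ((a k : ℕ) : ℝ) + 1 ≤ ((g k : ℕ) : ℝ) := by exact_mod_cast hk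
  have h5 : (0 : ℝ) < ((b : ℝ) ^ (k + 1))⁻¹ := by positivity
  rw [h1]
  unfold Real.ofDigitsTerm
  nlinarith

/-- `a` is lexicographically smaller than `g`, as witnessed by one of the first `M` digits. -/
def LexLt (M : ℕ) (a g : ℕ → Fin b) : Prop :=
  ∃ k < M, (∀ i < k, a i = g i) ∧ a k < g k

theorem lexLt_congr {M : ℕ} {a a' g : ℕ → Fin b} (h : ∀ k < M, a k = a' k) :
    LexLt M a g ↔ LexLt M a' g := by
  refine exists_congr fun k => and_congr_right fun hk => ?_
  rw [h k hk]
  refine and_congr_left fun _ => forall₂_congr fun i hi => ?_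
  rw [h i (hi.trans hk)]

theorem lexLt_succ {M : ℕ} {a g : ℕ → Fin b} :
    LexLt (M + 1) a g ↔ a 0 < g 0 ∨
      (a 0 = g 0 ∧ LexLt M (fun k => a (k + 1)) (fun k => g (k + 1))) := by
  constructor
  · rintro ⟨k, hk, hag, hlt⟩
    cases k with
    | zero => exact Or.inl hlt
    | succ k =>
      exact Or.inr ⟨hag 0 (by lia), k, by lia, fun i hi => hag (i + 1) (by lia), hlt⟩
  · rintro (h | ⟨h, k, hk, hag, hlt⟩)
    · exact ⟨0, by lia, by simp, h⟩
    · refine ⟨k + 1, by lia, fun i hi => ?_, hlt⟩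
      cases i with
      | zero => exact h
      | succ i => exact hag i (by lia)

variable [NeZero b]

/-- If all digits from `l` on were `b - 1`, then `b ^ l * γ` would equal its own floor plus one. -/
theorem exists_digit_ne_last (hb : 1 < b) {γ : ℝ} (hγ : γ ∈ Set.Ico (0 : ℝ) 1) (l : ℕ) :
    ∃ k, l ≤ k ∧ (Real.digits γ b k : ℕ) ≠ b - 1 := by
  by_contra! h
  have h1 := Real.ofDigits_eq_sum_add_ofDigits (Real.digits γ b) l
  have h2 : (fun i => Real.digits γ b (i + l)) = fun _ => ⟨b - 1, Nat.sub_one_lt_of_lt hb⟩ :=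
    funext fun i => Fin.ext (h _ (Nat.le_add_left l i))
  rw [Real.ofDigits_digits hb hγ, h2, Real.ofDigits_const_last_eq_one' hb] at h1
  have h3 := Real.ofDigits_digits_sum_eq (b := b) hγ l
  have h4 := Nat.lt_floor_add_one ((b : ℝ) ^ l * γ)
  have hb0 : (0 : ℝ) < (b : ℝ) ^ l := by positivity
  rw [← h3] at h4
  conv_lhs at h4 => rw [h1]
  rw [mul_add, mul_one, mul_inv_cancel₀ hb0.ne'] at h4
  exact lt_irrefl _ h4

theorem ofDigits_lt_iff (hb : 1 < b) {γ : ℝ} (hγ : γ ∈ Set.Ico (0 : ℝ) 1) {a : ℕ → Fin b} {T : ℕ}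
    (ha : ∀ k, T ≤ k → a k = 0) :
    Real.ofDigits a < γ ↔ ∃ M, LexLt M a (Real.digits γ b) := by
  have hlast : ∀ l, ∃ k, l < k ∧ (a k : ℕ) ≠ b - 1 := fun l =>
    ⟨max (l + 1) T, by lia, by rw [ha _ (le_max_right _ _), Fin.val_zero]; lia⟩
  constructor
  · intro h
    by_contra! hno
    by_cases heq : ∀ k, a k = Real.digits γ b k
    · rw [funext heq, Real.ofDigits_digits hb hγ] at h
      exact lt_irrefl _ h
    · push Not at heq
      classical
      have hmin : ∀ i < Nat.find heq, a i = Real.digits γ b i := fun i hi =>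
        not_not.1 (Nat.find_min heq hi)
      rcases lt_or_gt_of_ne (Nat.find_spec heq) with hlt | hgt
      · exact hno (Nat.find heq + 1) ⟨_, Nat.lt_succ_self _, hmin, hlt⟩
      · obtain ⟨k', hk', hne⟩ := exists_digit_ne_last hb hγ (Nat.find heq + 1)
        have := ofDigits_lt_of_lex hb (fun i hi => (hmin i hi).symm) hgt hk' hne
        rw [Real.ofDigits_digits hb hγ] at this
        exact lt_asymm h this
  · rintro ⟨M, k, -, hag, hlt⟩
    obtain ⟨k', hk', hne⟩ := hlast k
    have := ofDigits_lt_of_lex hb hag hlt hk' hne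
    rwa [Real.ofDigits_digits hb hγ] at this

/-- Extension of a digit string by zeros. -/
def zeroExtend {M : ℕ} (y : Fin M → Fin b) (k : ℕ) : Fin b :=
  if h : k < M then y ⟨k, h⟩ else 0

open scoped Classical in
-- Split off the first digit: a smaller one leaves the other `M` digits free, an equal one leads to
-- the shifted problem.
theorem card_lexLt (M : ℕ) {g : ℕ → Fin b} (hg : ∀ k, M ≤ k → g k = 0) :
    ((Finset.univ.filter fun y : Fin M → Fin b => LexLt M (zeroExtend y) g).card : ℝ) =
      (b : ℝ) ^ M * Real.ofDigits g := by
  have hb0 : (b : ℝ) ≠ 0 := Nat.cast_ne_zero.2 (NeZero.ne b)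
  induction M generalizing g with
  | zero =>
    have : Real.ofDigits g = 0 := by
      rw [Real.ofDigits]
      refine (tsum_congr fun i => ?_).trans tsum_zero
      simp [Real.ofDigitsTerm, hg i]
    simp [LexLt, this]
  | succ M ih =>
    have h1 := ih (g := fun k => g (k + 1)) fun k hk => hg _ (by lia)
    have h2 : (Finset.univ.filter fun y : Fin (M + 1) → Fin b =>
        LexLt (M + 1) (zeroExtend y) g).card =
        ∑ a : Fin b, (Finset.univ.filter fun y : Fin M → Fin b =>
          LexLt (M + 1) (zeroExtend (Fin.cons a y)) g).card := by
      simp only [Finset.card_filter]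
      rw [← (Fin.consEquiv fun _ : Fin (M + 1) => Fin b).sum_comp, Fintype.sum_prod_type]
      rfl
    have h3 : ∀ a : Fin b, ((Finset.univ.filter fun y : Fin M → Fin b =>
          LexLt (M + 1) (zeroExtend (Fin.cons a y)) g).card : ℝ) =
        (if a < g 0 then (b : ℝ) ^ M else 0) +
          if a = g 0 then (b : ℝ) ^ M * Real.ofDigits (fun k => g (k + 1)) else 0 := by
      intro a
      have h4 : ∀ y : Fin M → Fin b, LexLt (M + 1) (zeroExtend (Fin.cons a y : Fin (M + 1) → Fin b)) g ↔
          a < g 0 ∨ (a = g 0 ∧ LexLt M (zeroExtend y) fun k => g (k + 1)) := by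
        intro y
        rw [lexLt_succ]
        have e0 : zeroExtend (Fin.cons a y : Fin (M + 1) → Fin b) 0 = a := by simp [zeroExtend]
        have e1 : (fun k => zeroExtend (Fin.cons a y : Fin (M + 1) → Fin b) (k + 1)) =
            zeroExtend y := by
          funext k
          by_cases hk : k < M
          · have hk' : k + 1 < M + 1 := by lia
            rw [zeroExtend, zeroExtend, dif_pos hk, dif_pos hk']
            exact Fin.cons_succ (α := fun _ => Fin b) a y ⟨k, hk⟩
          · have hk' : ¬ k + 1 < M + 1 := by lia
            rw [zeroExtend, zeroExtend, dif_neg hk, dif_neg hk']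
        rw [e0, e1]
      simp only [h4]
      rcases lt_trichotomy a (g 0) with h | h | h
      · have hall : (Finset.univ.filter fun y : Fin M → Fin b =>
            a < g 0 ∨ (a = g 0 ∧ LexLt M (zeroExtend y) fun k => g (k + 1))) = Finset.univ :=
          Finset.filter_true_of_mem fun _ _ => Or.inl h
        rw [hall, if_pos h, if_neg h.ne, Finset.card_univ]
        simp
      · simp only [h, lt_irrefl, false_or, true_and, if_true, if_false, zero_add]
        exact h1
      · simp [h.not_gt, h.ne']
    rw [h2, Nat.cast_sum, Finset.sum_congr rfl fun a _ => h3 a, Finset.sum_add_distrib,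
      Finset.sum_ite_eq' Finset.univ (g 0), if_pos (Finset.mem_univ _), ← Finset.sum_filter,
      Finset.sum_const, Real.ofDigits_eq_sum_add_ofDigits g 1]
    have h5 : (Finset.univ.filter fun a : Fin b => a < g 0).card = (g 0 : ℕ) := by
      rw [Finset.filter_gt_eq_Iio, Fin.card_Iio]
    rw [h5]
    simp [Real.ofDigitsTerm]
    field_simp
    ring

end Digits

/-! ### The vectors attached to integers and their equidistribution. -/

section Points

variable {K V : Type*} [Field K] [AddCommGroup V] [Module K V] {b : ℕ} [NeZero b]

theorem natDigit_val (n r : ℕ) : (natDigit b n r : ℕ) = n / b ^ r % b := rfl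

theorem natDigit_eq_zero {n r : ℕ} (h : n < b ^ r) : natDigit b n r = 0 :=
  Fin.ext (by rw [natDigit_val, Nat.div_eq_of_lt h]; simp)

theorem natDigit_mul_pow_add {B R n r : ℕ} (hn : n < b ^ R) :
    natDigit b (B * b ^ R + n) r =
      if r < R then natDigit b n r else natDigit b (B * b ^ R) r := by
  have hb : 0 < b := NeZero.pos b
  apply Fin.ext
  split_ifs with h
  · obtain ⟨d, rfl⟩ := Nat.exists_eq_add_of_lt h
    rw [natDigit_val, natDigit_val,
      show B * b ^ (r + d + 1) + n = n + b ^ r * (b * (B * b ^ d)) by ring,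
      Nat.add_mul_div_left _ _ (by positivity), Nat.add_mul_mod_self_left]
  · obtain ⟨d, rfl⟩ := Nat.exists_eq_add_of_le (not_lt.1 h)
    rw [natDigit_val, natDigit_val, pow_add, ← Nat.div_div_eq_div_mul, ← Nat.div_div_eq_div_mul,
      mul_comm B, Nat.mul_add_div (by positivity), Nat.div_eq_of_lt hn, add_zero,
      Nat.mul_div_cancel_left _ (by positivity)]

theorem natDigit_mul_pow_eq_zero {B R r : ℕ} (h : r < R) : natDigit b (B * b ^ R) r = 0 := by
  have := natDigit_mul_pow_add (b := b) (B := B) (R := R) (n := 0) (r := r)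
    (Nat.pow_pos (NeZero.pos b))
  rw [add_zero, if_pos h] at this
  rw [this]
  exact Fin.ext (by rw [natDigit_val]; simp)

/-- The vector with the digits of `n` as its coordinates in the basis `w`. -/
def digitPoint (φ : Fin b ≃ K) (w : ℕ → V) (n : ℕ) : V :=
  ∑ r ∈ Finset.range n, φ (natDigit b n r) • w r

variable {φ : Fin b ≃ K} (w : Module.Basis ℕ K V)

theorem repr_digitPoint (hφ : φ 0 = 0) (hb : 1 < b) (n r : ℕ) :
    w.repr (digitPoint φ w n) r = φ (natDigit b n r) := by
  rw [digitPoint, map_sum, Finsupp.finsetSum_apply]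
  by_cases h : r < n
  · rw [Finset.sum_eq_single r]
    · simp
    · intro r' _ hr'
      simp [hr']
    · simp [h]
  · rw [natDigit_eq_zero ((Nat.lt_pow_self hb).trans_le (Nat.pow_le_pow_right hb.le (not_lt.1 h))),
      hφ]
    refine Finset.sum_eq_zero fun r' hr' => ?_
    have : r' ≠ r := by have := Finset.mem_range.1 hr'; lia
    simp [this]

/-- There is no carry. Additivity is limited to such sums, since `φ` is just a bijection with `φ 0 =
0`. -/
theorem digitPoint_mul_pow_add (hφ : φ 0 = 0) (hb : 1 < b) {B R n : ℕ} (hn : n < b ^ R) :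
    digitPoint φ w (B * b ^ R + n) = digitPoint φ w (B * b ^ R) + digitPoint φ w n := by
  refine w.ext_elem fun r => ?_
  rw [map_add, Finsupp.add_apply, repr_digitPoint w hφ hb, repr_digitPoint w hφ hb,
    repr_digitPoint w hφ hb, natDigit_mul_pow_add hn]
  split_ifs with h
  · rw [natDigit_mul_pow_eq_zero h, hφ, zero_add]
  · rw [natDigit_eq_zero (hn.trans_le (Nat.pow_le_pow_right hb.le (not_lt.1 h))), hφ, add_zero]

theorem exists_digitPoint_eq (hφ : φ 0 = 0) (hb : 1 < b) {R : ℕ} {v : V}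
    (hv : ∀ r, R ≤ r → w.repr v r = 0) : ∃ n < b ^ R, digitPoint φ w n = v := by
  let e : Fin (b ^ R) := finFunctionFinEquiv fun r : Fin R => φ.symm (w.repr v r)
  refine ⟨e, e.2, w.ext_elem fun r => ?_⟩
  rw [repr_digitPoint w hφ hb]
  by_cases h : r < R
  · have h1 : natDigit b e r = finFunctionFinEquiv.symm e ⟨r, h⟩ := Fin.ext (by
      rw [natDigit_val, finFunctionFinEquiv_symm_apply_val])
    rw [h1, Equiv.symm_apply_apply, Equiv.apply_symm_apply]
  · rw [natDigit_eq_zero (e.2.trans_le (Nat.pow_le_pow_right hb.le (not_lt.1 h))), hφ,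
      hv r (not_lt.1 h)]

theorem digitPoint_injective (hφ : φ 0 = 0) (hb : 1 < b) :
    Function.Injective (digitPoint φ w) := by
  intro n n' h
  have hd : ∀ r, natDigit b n r = natDigit b n' r := fun r => φ.injective (by
    rw [← repr_digitPoint w hφ hb, ← repr_digitPoint w hφ hb, h])
  have hn : ∀ m, m ≤ max n n' → m < b ^ max n n' := fun m hm =>
    hm.trans_lt (Nat.lt_pow_self hb)
  have : (⟨n, hn n (le_max_left _ _)⟩ : Fin (b ^ max n n')) = ⟨n', hn n' (le_max_right _ _)⟩ := by
    apply finFunctionFinEquiv.symm.injective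
    funext r
    apply Fin.ext
    rw [finFunctionFinEquiv_symm_apply_val, finFunctionFinEquiv_symm_apply_val]
    exact congrArg Fin.val (hd r)
  exact congrArg Fin.val this

/-- Vectors with vanishing first coordinates are the points at multiples of a power of `b`. -/
theorem exists_digitPoint_mul_pow_eq (hφ : φ 0 = 0) (hb : 1 < b) {R : ℕ} {v : V}
    (hv : ∀ r < R, w.repr v r = 0) : ∃ B, digitPoint φ w (B * b ^ R) = v := by
  obtain ⟨T, hT⟩ : ∃ T, ∀ r, T ≤ r → w.repr v r = 0 := by
    refine ⟨(w.repr v).support.sup id + 1, fun r hr => ?_⟩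
    by_contra hne
    have := Finset.le_sup (f := id) (Finsupp.mem_support_iff.2 hne)
    simp only [id] at this
    lia
  obtain ⟨n, -, hn⟩ := exists_digitPoint_eq w hφ hb hT
  have hlt : n % b ^ R < b ^ R := Nat.mod_lt _ (Nat.pow_pos (NeZero.pos b))
  refine ⟨n / b ^ R, ?_⟩
  have h1 := digitPoint_mul_pow_add w hφ hb (B := n / b ^ R) hlt
  rw [mul_comm, Nat.div_add_mod, hn] at h1
  have h2 : digitPoint φ w (n % b ^ R) = 0 := by
    refine w.ext_elem fun r => ?_
    rw [map_zero, Finsupp.zero_apply]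
    by_cases h : r < R
    · have h3 := congrArg (fun v => w.repr v r) h1
      simp only [map_add, Finsupp.add_apply, hv r h] at h3
      rw [mul_comm (b ^ R), repr_digitPoint w hφ hb (n / b ^ R * b ^ R), natDigit_mul_pow_eq_zero h,
        hφ, zero_add] at h3
      exact h3.symm
    · rw [repr_digitPoint w hφ hb,
        natDigit_eq_zero (hlt.trans_le (Nat.pow_le_pow_right hb.le (not_lt.1 h))), hφ]
  rw [h2, add_zero, mul_comm] at h1
  exact h1.symm

/-- Equidistribution of the first `b ^ R` points under a linear map that is already surjective
on these points. -/
theorem sum_digitPoint_eq (hφ : φ 0 = 0) (hb : 1 < b) {Q : Type*} [AddCommGroup Q] [Module K Q]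
    [Fintype Q] (ψ : V →ₗ[K] Q) {R : ℕ} (hψ : ∀ Y, ∃ n < b ^ R, ψ (digitPoint φ w n) = Y)
    (h : Q → ℝ) (y : Q) :
    (Fintype.card Q : ℝ) * ∑ n ∈ Finset.range (b ^ R), h (y + ψ (digitPoint φ w n)) =
      (b : ℝ) ^ R * ∑ Y, h Y := by
  classical
  let A : Finset V := (Finset.range (b ^ R)).image (digitPoint φ w)
  have hA : ∀ v, v ∈ A ↔ ∀ r, R ≤ r → w.repr v r = 0 := by
    intro v
    simp only [A, Finset.mem_image, Finset.mem_range]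
    constructor
    · rintro ⟨n, hn, rfl⟩ r hr
      rw [repr_digitPoint w hφ hb,
        natDigit_eq_zero (hn.trans_le (Nat.pow_le_pow_right hb.le hr)), hφ]
    · exact exists_digitPoint_eq w hφ hb
  have hsum : ∀ y, ∑ n ∈ Finset.range (b ^ R), h (y + ψ (digitPoint φ w n)) =
      ∑ v ∈ A, h (y + ψ v) := fun y => by
    rw [Finset.sum_image fun _ _ _ _ e => digitPoint_injective w hφ hb e]
  -- `A` is closed under addition and subtraction and maps onto `Q`, so the sum does not depend on
  -- the translate; averaging over all translates evaluates it.
  have hconst : ∀ y', ∑ v ∈ A, h (y' + ψ v) = ∑ v ∈ A, h (y + ψ v) := by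
    intro y'
    obtain ⟨m, hm, hmy⟩ := hψ (y' - y)
    set u := digitPoint φ w m
    have hu : ∀ r, R ≤ r → w.repr u r = 0 :=
      (hA u).1 (Finset.mem_image_of_mem _ (Finset.mem_range.2 hm))
    refine Finset.sum_bij' (fun v _ => v + u) (fun v _ => v - u) ?_ ?_ ?_ ?_ ?_
    · intro v hv
      rw [hA] at hv ⊢
      intro r hr
      rw [map_add, Finsupp.add_apply, hv r hr, hu r hr, add_zero]
    · intro v hv
      rw [hA] at hv ⊢
      intro r hr
      rw [map_sub, Finsupp.sub_apply, hv r hr, hu r hr, sub_zero]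
    · intro v _; exact add_sub_cancel_right v u
    · intro v _; exact sub_add_cancel v u
    · intro v _
      rw [map_add, hmy]
      congr 1
      abel
  calc (Fintype.card Q : ℝ) * ∑ n ∈ Finset.range (b ^ R), h (y + ψ (digitPoint φ w n))
      = ∑ y' : Q, ∑ v ∈ A, h (y' + ψ v) := by
        rw [Finset.sum_congr rfl fun y' _ => hconst y', Finset.sum_const, Finset.card_univ,
          nsmul_eq_mul, hsum]
    _ = ∑ v ∈ A, ∑ Y, h Y := by
        rw [Finset.sum_comm]
        exact Finset.sum_congr rfl fun v _ => Equiv.sum_comp (Equiv.addRight (ψ v)) h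
    _ = (b : ℝ) ^ R * ∑ Y, h Y := by
        rw [Finset.sum_const, nsmul_eq_mul,
          Finset.card_image_of_injective _ (digitPoint_injective w hφ hb), Finset.card_range]
        push_cast; rfl

end Points

end HaltonFF
end

noncomputable section
namespace HaltonFF

/-! ### The sequence and the box in terms of coordinates. -/

section Coordinates

variable {K V : Type*} [Field K] [AddCommGroup V] [Module K V] {b : ℕ} [NeZero b] {s : ℕ}

/-- The first `M` coordinates with respect to the bases `w 1, …, w s`. -/
def coordMap (w : Fin (s + 1) → Module.Basis ℕ K V) (M : ℕ) : V →ₗ[K] (Fin s → Fin M → K) :=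
  LinearMap.pi fun i => LinearMap.pi fun k => (w i.succ).coord k

theorem coordMap_apply (w : Fin (s + 1) → Module.Basis ℕ K V) (M : ℕ) (v : V) (i : Fin s)
    (k : Fin M) : coordMap w M v i k = (w i.succ).repr v k := rfl

/-- Finitely many coordinates in all of the bases can be prescribed simultaneously. -/
def JointlyIndependent (w : Fin (s + 1) → Module.Basis ℕ K V) : Prop :=
  ∀ (m : ℕ) (e : Fin (s + 1) → ℕ → K), ∃ v : V, ∀ i, ∀ l < m, (w i).repr v l = e i l

theorem JointlyIndependent.exists_coordMap_eq {w : Fin (s + 1) → Module.Basis ℕ K V}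
    (hw : JointlyIndependent w) (M R : ℕ) (Y : Fin s → Fin M → K) :
    ∃ v : V, (∀ r < R, (w 0).repr v r = 0) ∧ coordMap w M v = Y := by
  obtain ⟨v, hv⟩ := hw (max M R)
    (Fin.cons (fun _ => 0) fun i k => if h : k < M then Y i ⟨k, h⟩ else 0)
  refine ⟨v, fun r hr => ?_, ?_⟩
  · rw [hv 0 r (by lia)]; rfl
  · funext i k
    rw [coordMap_apply, hv i.succ k (by have := k.2; lia)]
    simp

theorem exists_surjective_block {φ : Fin b ≃ K} (hφ : φ 0 = 0) (hb : 1 < b)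
    (w : Module.Basis ℕ K V) {Q : Type*} [AddCommGroup Q] [Module K Q] [Finite Q]
    {ψ : V →ₗ[K] Q} (hψ : Function.Surjective ψ) :
    ∃ R, ∀ Y, ∃ n < b ^ R, ψ (digitPoint φ w n) = Y := by
  have h1 : ∀ Y, ∃ n, ψ (digitPoint φ w n) = Y := by
    intro Y
    obtain ⟨v, rfl⟩ := hψ Y
    obtain ⟨B, hB⟩ := exists_digitPoint_mul_pow_eq w hφ hb (R := 0) (v := v) (by simp)
    exact ⟨_, by rw [hB]⟩
  choose n hn using h1
  have := Fintype.ofFinite Q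
  refine ⟨Finset.univ.sup n, fun Y => ⟨n Y, ?_, hn Y⟩⟩
  exact (Nat.lt_pow_self hb).trans_le
    (Nat.pow_le_pow_right hb.le (Finset.le_sup (Finset.mem_univ Y)))

/-- The matrices expressing the basis `w 0` in the other bases. -/
def transitionMatrix (w : Fin (s + 1) → Module.Basis ℕ K V) (i : Fin s) (j r : ℕ) : K :=
  (w i.succ).repr (w 0 r) j

theorem digitalVector_transitionMatrix (φ : Fin b ≃ K) (w : Fin (s + 1) → Module.Basis ℕ K V)
    (n : ℕ) (i : Fin s) (j : ℕ) :
    digitalVector φ (transitionMatrix w) n i j =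
      (w i.succ).repr (digitPoint φ (w 0) n) j := by
  simp [digitalVector, transitionMatrix, digitPoint, Finsupp.finsetSum_apply]

/-- The digit string of a vector with respect to a basis. -/
def digitString (φ : Fin b ≃ K) (w : Module.Basis ℕ K V) (v : V) (k : ℕ) : Fin b :=
  φ.symm (w.repr v k)

/-- The anchored box with upper corner given by digit strings, within the first `M` digits. -/
def InBox {M : ℕ} (φ : Fin b ≃ K) (g : Fin s → ℕ → Fin b) (Y : Fin s → Fin M → K) : Prop :=
  ∀ i, LexLt M (zeroExtend fun k => φ.symm (Y i k)) (g i)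

theorem inBox_coordMap {φ : Fin b ≃ K} {g : Fin s → ℕ → Fin b}
    {w : Fin (s + 1) → Module.Basis ℕ K V} {M : ℕ} {v : V} :
    InBox φ g (coordMap w M v) ↔ ∀ i, LexLt M (digitString φ (w i.succ) v) (g i) := by
  refine forall_congr' fun i => lexLt_congr fun k hk => ?_
  rw [zeroExtend, dif_pos hk]; rfl

/-- Coordinates of a vector have finite support, so the digit string of a point ends in zeros and
numerical order is lexicographic order. -/
theorem digitalSequence_mem_box_iff {φ : Fin b ≃ K} (hφ : φ 0 = 0) (hb : 1 < b)
    (w : Fin (s + 1) → Module.Basis ℕ K V) {γ : Fin s → ℝ} (hγ : ∀ i, γ i ∈ Set.Ioo (0 : ℝ) 1)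
    (n : ℕ) :
    digitalSequence φ (transitionMatrix w) n ∈ Set.univ.pi (fun i => Set.Ico 0 (γ i)) ↔
      ∀ i, ∃ M, LexLt M (digitString φ (w i.succ) (digitPoint φ (w 0) n))
        (Real.digits (γ i) b) := by
  rw [Set.mem_univ_pi]
  refine forall_congr' fun i => ?_
  have h1 : digitalSequence φ (transitionMatrix w) n i =
      Real.ofDigits (digitString φ (w i.succ) (digitPoint φ (w 0) n)) := by
    unfold digitalSequence
    congr 1
    funext j
    rw [digitalVector_transitionMatrix]; rfl
  set v := digitPoint φ (w 0) n
  rw [h1, Set.mem_Ico, and_iff_right (Real.ofDigits_nonneg _)]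
  refine ofDigits_lt_iff hb (Set.Ioo_subset_Ico_self (hγ i))
    (T := ((w i.succ).repr v).support.sup id + 1) fun k hk => ?_
  have : (w i.succ).repr v k = 0 := by
    by_contra hne
    have := Finset.le_sup (f := id) (Finsupp.mem_support_iff.2 hne)
    simp only [id] at this
    lia
  rw [digitString, this, ← hφ, Equiv.symm_apply_apply]

theorem volume_box_toReal {γ : Fin s → ℝ} (hγ : ∀ i, γ i ∈ Set.Ioo (0 : ℝ) 1) :
    (MeasureTheory.volume (Set.univ.pi fun i => Set.Ico 0 (γ i))).toReal = ∏ i, γ i := by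
  rw [Real.volume_pi_Ico_toReal (a := fun _ => 0) fun i => (hγ i).1.le]
  simp

open scoped Classical in
theorem card_inBox {L : Type*} [Fintype L] (φ : Fin b ≃ L) (M : ℕ) {g : Fin s → ℕ → Fin b}
    (hg : ∀ i k, M ≤ k → g i k = 0) :
    ((Finset.univ.filter fun Y : Fin s → Fin M → L => InBox φ g Y).card : ℝ) =
      ((b : ℝ) ^ M) ^ s * ∏ i, Real.ofDigits (g i) := by
  have h1 : (Finset.univ.filter fun Y : Fin s → Fin M → L => InBox φ g Y) =
      Fintype.piFinset fun i => Finset.univ.filter fun y : Fin M → L =>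
        LexLt M (zeroExtend fun k => φ.symm (y k)) (g i) := by
    ext Y
    simp only [Finset.mem_filter, Finset.mem_univ, true_and, Fintype.mem_piFinset]
    rfl
  have h2 : ∀ i, ((Finset.univ.filter fun y : Fin M → L =>
        LexLt M (zeroExtend fun k => φ.symm (y k)) (g i)).card : ℝ) =
      (b : ℝ) ^ M * Real.ofDigits (g i) := by
    intro i
    rw [← card_lexLt M (hg i), Finset.card_filter, Finset.card_filter]
    congr 1
    exact Equiv.sum_comp (Equiv.piCongrRight fun _ : Fin M => φ.symm)
      (fun y => if LexLt M (zeroExtend y) (g i) then 1 else 0)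
  rw [h1, Fintype.card_piFinset, Nat.cast_prod, Finset.prod_congr rfl fun i _ => h2 i,
    Finset.prod_mul_distrib]
  simp

end Coordinates

theorem abs_sum_range_le_of_block_sum_eq_zero {u : ℕ → ℝ} {T : ℕ} (hT : 0 < T) {A : ℝ}
    (hu : ∀ n, |u n| ≤ A) (hblock : ∀ B, ∑ n ∈ Finset.range T, u (B * T + n) = 0) (N : ℕ) :
    |∑ n ∈ Finset.range N, u n| ≤ T * A := by
  have hA : 0 ≤ A := (abs_nonneg _).trans (hu 0)
  have hfull : ∀ B, ∑ n ∈ Finset.range (B * T), u n = 0 := by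
    intro B
    induction B with
    | zero => simp
    | succ B ih => rw [Nat.succ_mul, Finset.sum_range_add, ih, hblock, add_zero]
  have hN : N = N / T * T + N % T := by rw [mul_comm, Nat.div_add_mod]
  rw [hN, Finset.sum_range_add, hfull, zero_add]
  calc |∑ n ∈ Finset.range (N % T), u (N / T * T + n)|
      ≤ ∑ n ∈ Finset.range (N % T), |u (N / T * T + n)| := Finset.abs_sum_le_sum_abs _ _
    _ ≤ ∑ _n ∈ Finset.range (N % T), A := Finset.sum_le_sum fun n _ => hu _
    _ = (N % T : ℕ) * A := by rw [Finset.sum_const, Finset.card_range, nsmul_eq_mul]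
    _ ≤ T * A := by
        gcongr
        exact (Nat.mod_lt N hT).le

/-! ### Finitely many digits imply bounded remainder. -/

section Sufficiency

variable {K V : Type*} [Field K] [Finite K] [AddCommGroup V] [Module K V] {b : ℕ} [NeZero b]
  {s : ℕ}

theorem isBoundedRemainderSet_of_finite_digits {φ : Fin b ≃ K} (hφ : φ 0 = 0) (hb : 1 < b)
    {w : Fin (s + 1) → Module.Basis ℕ K V} (hw : JointlyIndependent w) {γ : Fin s → ℝ}
    (hγ : ∀ i, γ i ∈ Set.Ioo (0 : ℝ) 1)
    (hfin : ∀ i, {j : ℕ | Real.digits (γ i) b j ≠ 0}.Finite) :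
    IsBoundedRemainderSet (digitalSequence φ (transitionMatrix w))
      (Set.univ.pi fun i => Set.Ico 0 (γ i)) := by
  classical
  have := Fintype.ofFinite K
  have hcardK : Fintype.card K = b := by
    rw [← Fintype.card_congr φ, Fintype.card_fin]
  set g : Fin s → ℕ → Fin b := fun i => Real.digits (γ i) b with hgdef
  obtain ⟨M, hM⟩ : ∃ M, ∀ i k, M ≤ k → g i k = 0 := by
    have h1 : ∀ i, ∃ m, ∀ k, m ≤ k → g i k = 0 := by
      intro i
      obtain ⟨m, hm⟩ := (hfin i).bddAbove
      refine ⟨m + 1, fun k hk => ?_⟩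
      by_contra hne
      have := hm hne
      lia
    choose m hm using h1
    exact ⟨Finset.univ.sup m, fun i k hk =>
      hm i k ((Finset.le_sup (Finset.mem_univ i)).trans hk)⟩
  set lam := ∏ i, γ i with hlam
  -- Beyond place `M` the digits of `g` are `0`, and nothing is smaller than `0`, so a comparison is
  -- decided before `M`.
  have hbox : ∀ n, digitalSequence φ (transitionMatrix w) n ∈
      Set.univ.pi (fun i => Set.Ico 0 (γ i)) ↔
      InBox φ g (coordMap w M (digitPoint φ (w 0) n)) := by
    intro n
    rw [digitalSequence_mem_box_iff hφ hb w hγ, inBox_coordMap]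
    refine forall_congr' fun i => ⟨?_, fun h => ⟨M, h⟩⟩
    rintro ⟨M', k, -, hag, hlt⟩
    refine ⟨k, ?_, hag, hlt⟩
    by_contra hk
    change _ < g i k at hlt
    rw [hM i k (not_lt.1 hk)] at hlt
    exact not_lt_zero hlt
  let h : (Fin s → Fin M → K) → ℝ := fun Y => if InBox φ g Y then 1 else 0
  let u : ℕ → ℝ := fun n => h (coordMap w M (digitPoint φ (w 0) n)) - lam
  have hcardQ : (Fintype.card (Fin s → Fin M → K) : ℝ) = ((b : ℝ) ^ M) ^ s := by
    simp [hcardK]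
  have hsumh : ∑ Y, h Y = ((b : ℝ) ^ M) ^ s * lam := by
    simp only [h, Finset.sum_boole]
    rw [card_inBox φ M hM]
    congr 1
    exact Finset.prod_congr rfl fun i _ =>
      Real.ofDigits_digits hb (Set.Ioo_subset_Ico_self (hγ i))
  have hbpos : (0 : ℝ) < b := by exact_mod_cast NeZero.pos b
  obtain ⟨R, hR⟩ := exists_surjective_block hφ hb (w 0) (ψ := coordMap w M) fun Y =>
    (hw.exists_coordMap_eq M 0 Y).imp fun _ hv => hv.2
  refine ⟨(b ^ R : ℕ) * (1 + |lam|), fun N => ?_⟩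
  have hu : ∀ n, |u n| ≤ 1 + |lam| := by
    intro n
    refine (abs_sub _ _).trans (add_le_add_left ?_ _)
    simp only [h]
    split_ifs <;> simp
  have hblock : ∀ B, ∑ n ∈ Finset.range (b ^ R), u (B * b ^ R + n) = 0 := by
    intro B
    have h1 := sum_digitPoint_eq (w 0) hφ hb (coordMap w M) hR h
      (coordMap w M (digitPoint φ (w 0) (B * b ^ R)))
    rw [hcardQ, hsumh] at h1
    have h2 : ∑ n ∈ Finset.range (b ^ R), u (B * b ^ R + n) =
        ∑ n ∈ Finset.range (b ^ R), h (coordMap w M (digitPoint φ (w 0) (B * b ^ R)) +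
          coordMap w M (digitPoint φ (w 0) n)) - (b : ℝ) ^ R * lam := by
      simp only [u]
      rw [Finset.sum_sub_distrib, Finset.sum_const, Finset.card_range, nsmul_eq_mul]
      push_cast
      congr 1
      refine Finset.sum_congr rfl fun n hn => ?_
      rw [digitPoint_mul_pow_add (w 0) hφ hb (Finset.mem_range.1 hn), map_add]
    rw [h2, sub_eq_zero]
    have h3 : ((b : ℝ) ^ M) ^ s ≠ 0 := by positivity
    apply mul_left_cancel₀ h3
    rw [h1]; ring
  have h4 := abs_sum_range_le_of_block_sum_eq_zero (Nat.pow_pos (NeZero.pos b)) hu hblock N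
  refine le_trans (le_of_eq ?_) h4
  congr 1
  refine Finset.sum_congr rfl fun n _ => ?_
  rw [volume_box_toReal hγ, Set.indicator_apply]
  simp only [u, h, hbox]
  rfl

end Sufficiency

end HaltonFF
end

noncomputable section
namespace HaltonFF

/-! ### Digit strings near a mixed place. -/

section Strings

variable {b : ℕ} [NeZero b]

/-- The two digits after place `l` are neither both `0` nor both `b - 1`. -/
def IsMixedAt (g : ℕ → Fin b) (l : ℕ) : Prop :=
  ¬ (g (l + 1) = 0 ∧ g (l + 2) = 0) ∧
    ¬ ((g (l + 1) : ℕ) = b - 1 ∧ (g (l + 2) : ℕ) = b - 1)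

/-- Overlapping pairs that are all constant `0` or constant `b - 1` force an eventually constant
expansion. Pairs are needed since for `b = 2` every single digit is extremal. -/
theorem exists_isMixedAt {g : ℕ → Fin b} (hinf : {j | g j ≠ 0}.Infinite)
    (hlast : ∀ l, ∃ k, l ≤ k ∧ (g k : ℕ) ≠ b - 1) (l₀ : ℕ) : ∃ l, l₀ ≤ l ∧ IsMixedAt g l := by
  by_contra! h
  have h' : ∀ l, l₀ ≤ l → (g (l + 1) = 0 ∧ g (l + 2) = 0) ∨
      ((g (l + 1) : ℕ) = b - 1 ∧ (g (l + 2) : ℕ) = b - 1) := by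
    intro l hl
    have := h l hl
    unfold IsMixedAt at this
    tauto
  rcases h' l₀ le_rfl with ⟨h0, -⟩ | ⟨h0, -⟩
  · have hall : ∀ n, g (l₀ + 1 + n) = 0 := by
      intro n
      induction n with
      | zero => exact h0
      | succ n ih =>
        rcases h' (l₀ + n) (by lia) with h1 | h1
        · rw [← h1.2]; congr 1; lia
        · rw [show l₀ + n + 1 = l₀ + 1 + n by lia, ih, Fin.val_zero] at h1
          lia
    obtain ⟨j, hj, hlt⟩ := hinf.exists_gt (l₀ + 1)
    obtain ⟨n, rfl⟩ := Nat.exists_eq_add_of_le hlt.le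
    exact hj (hall n)
  · have hall : ∀ n, (g (l₀ + 1 + n) : ℕ) = b - 1 := by
      intro n
      induction n with
      | zero => exact h0
      | succ n ih =>
        rcases h' (l₀ + n) (by lia) with h1 | h1
        · rw [show l₀ + n + 1 = l₀ + 1 + n by lia] at h1
          rw [h1.1, Fin.val_zero] at ih
          lia
        · rw [← h1.2]; congr 2; lia
    obtain ⟨k, hk, hne⟩ := hlast (l₀ + 1)
    obtain ⟨n, rfl⟩ := Nat.exists_eq_add_of_le hk
    exact hne (hall n)

/-- The digit at `j` matters only when the earlier digits tie with `g`, and then lowering it from `b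
- 1` to `0` cannot leave the box. -/
theorem lexLt_of_lexLt_of_eq_off {M j : ℕ} {a a' g : ℕ → Fin b} (hb : 1 < b) (hj : j < M)
    (hne : ∀ k, k ≠ j → a k = a' k)
    (h : (∀ k < j, a k = g k) → a j = 0 ∧ (a' j : ℕ) = b - 1) (hlex : LexLt M a' g) :
    LexLt M a g := by
  obtain ⟨k, hk, hag, hlt⟩ := hlex
  rcases lt_or_ge k j with hkj | hkj
  · refine ⟨k, hk, fun i hi => ?_, ?_⟩
    · rw [hne i (by lia), hag i hi]
    · rwa [hne k (by lia)]
  · have hpre : ∀ i < j, a i = g i := fun i hi => by rw [hne i (by lia), hag i (by lia)]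
    obtain ⟨h0, h1⟩ := h hpre
    rcases hkj.eq_or_lt with rfl | hkj
    · have := (g j).2
      rw [Fin.lt_def, h1] at hlt
      lia
    · refine ⟨j, hj, hpre, ?_⟩
      rw [h0, Fin.lt_def, ← hag j hkj, h1, Fin.val_zero]
      lia

/-- The digit string that follows `g` up to place `l`, except for a `0` at place `j`, and then
continues with digits that separate it from `g` in the right direction. -/
def separatingString (g : ℕ → Fin b) (j l k : ℕ) : Fin b :=
  if k = j then 0 else if k ≤ l then g k else if (g j : ℕ) = b - 1 then g j else 0

/-- The `0` at place `j` already decides unless `g j = 0`. In that case the string continues with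
zeros after `l`, where `g` has a nonzero digit among the next two. -/
theorem lexLt_of_eq_separatingString {M j l : ℕ} {a g : ℕ → Fin b} (hb : 1 < b) (hjl : j ≤ l)
    (hM : l + 2 < M) (hg : IsMixedAt g l) (ha : ∀ k < l + 3, a k = separatingString g j l k) :
    LexLt M a g := by
  have hpre : ∀ k < j, a k = g k := fun k hk => by
    rw [ha k (by lia), separatingString, if_neg (by lia), if_pos (by lia)]
  have hj0 : a j = 0 := by rw [ha j (by lia), separatingString, if_pos rfl]
  by_cases h0 : g j = 0
  · have hpre' : ∀ k < l + 1, a k = g k := fun k hk => by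
      by_cases hkj : k = j
      · rw [hkj, hj0, h0]
      · rw [ha k (by lia), separatingString, if_neg hkj, if_pos (by lia)]
    have hlast : (g j : ℕ) ≠ b - 1 := by rw [h0, Fin.val_zero]; lia
    have h1 : ∀ k, l < k → k < l + 3 → a k = 0 := fun k hk hk' => by
      rw [ha k hk', separatingString, if_neg (by lia), if_neg (by lia), if_neg hlast]
    by_cases h2 : g (l + 1) = 0
    · have h3 : g (l + 2) ≠ 0 := fun h3 => hg.1 ⟨h2, h3⟩
      refine ⟨l + 2, hM, fun k hk => ?_, ?_⟩
      · by_cases hkl : k = l + 1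
        · rw [hkl, h1 _ (by lia) (by lia), h2]
        · exact hpre' k (by lia)
      · rw [h1 _ (by lia) (by lia)]; exact Fin.pos_iff_ne_zero.2 h3
    · refine ⟨l + 1, by lia, hpre', ?_⟩
      rw [h1 _ (by lia) (by lia)]; exact Fin.pos_iff_ne_zero.2 h2
  · exact ⟨j, by lia, hpre, by rw [hj0]; exact Fin.pos_iff_ne_zero.2 h0⟩

/-- The mirror case: `b - 1` at place `j` decides unless `g j = b - 1`, and then the filling by `b -
1` exceeds one of the next two digits of `g`. -/
theorem not_lexLt_of_eq_separatingString {M j l : ℕ} {a g : ℕ → Fin b} (hjl : j ≤ l)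
    (hg : IsMixedAt g l) (ha : ∀ k < l + 3, k ≠ j → a k = separatingString g j l k)
    (haj : (a j : ℕ) = b - 1) : ¬ LexLt M a g := by
  rintro ⟨k, hk, hag, hlt⟩
  have hpre : ∀ k ≤ l, k ≠ j → a k = g k := fun k hk hkj => by
    rw [ha k (by lia) hkj, separatingString, if_neg hkj, if_pos hk]
  have hgb : ∀ k, (g k : ℕ) ≤ b - 1 := fun k => by have := (g k).2; lia
  rw [Fin.lt_def] at hlt
  have hkj : k ≠ j := by
    rintro rfl
    have := hgb k
    lia
  have hjk : j < k := by
    by_contra hle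
    rw [hpre k (by lia) hkj] at hlt
    exact lt_irrefl _ hlt
  have hgj : (g j : ℕ) = b - 1 := by rw [← hag j hjk, haj]
  have h1 : ∀ k, l < k → k < l + 3 → (a k : ℕ) = b - 1 := fun k hk hk' => by
    rw [ha k hk' (by lia), separatingString, if_neg (by lia), if_neg (by lia), if_pos hgj, hgj]
  have hkl : l < k := by
    by_contra hle
    rw [hpre k (by lia) hkj] at hlt
    exact lt_irrefl _ hlt
  have hkl3 : ¬ k < l + 3 := fun h => by
    rw [h1 k hkl h] at hlt
    have := hgb k
    lia
  exact hg.2 ⟨by rw [← hag _ (by lia), h1 _ (by lia) (by lia)],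
    by rw [← hag _ (by lia), h1 _ (by lia) (by lia)]⟩

end Strings

/-! ### The critical number of points. -/

section Numbers

/-- The gap of two puts all later powers above `b ^ ρ t`. So a single sum leaves, for every `t`, a
remainder below `b ^ ρ t` of the right order of magnitude. -/
theorem exists_add_of_sum_pow {b : ℕ} (hb : 1 < b) {ρ : ℕ → ℕ} (hρ1 : ∀ t, 1 ≤ ρ t)
    (hρ : ∀ t, ρ t + 2 ≤ ρ (t + 1)) {t T : ℕ} (ht : t < T) :
    ∃ B n, ∑ i ∈ Finset.range T, b ^ (ρ i - 1) = B * b ^ (ρ t + 1) + n ∧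
      n < b ^ ρ t ∧ b ^ (ρ t - 1) ≤ n := by
  have hsplit : ∀ t, b ^ ρ t = b * b ^ (ρ t - 1) := fun t => by
    rw [← pow_succ', Nat.sub_add_cancel (hρ1 t)]
  have hlt : ∀ t, ∑ i ∈ Finset.range (t + 1), b ^ (ρ i - 1) < b ^ ρ t := by
    intro t
    induction t with
    | zero =>
      rw [zero_add, Finset.sum_range_one]
      exact Nat.pow_lt_pow_right hb (by have := hρ1 0; lia)
    | succ t ih =>
      rw [Finset.sum_range_succ, hsplit (t + 1)]
      have h1 : b ^ ρ t ≤ b ^ (ρ (t + 1) - 1) :=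
        Nat.pow_le_pow_right hb.le (by have := hρ t; lia)
      have h2 : 2 * b ^ (ρ (t + 1) - 1) ≤ b * b ^ (ρ (t + 1) - 1) := Nat.mul_le_mul_right _ hb
      linarith
  have hmono : StrictMono ρ := strictMono_nat_of_lt_succ fun t => by have := hρ t; lia
  have hdvd : b ^ (ρ t + 1) ∣ ∑ i ∈ Finset.Ico (t + 1) T, b ^ (ρ i - 1) := by
    refine Finset.dvd_sum fun i hi => pow_dvd_pow _ ?_
    have h1 := hmono.monotone (Finset.mem_Ico.1 hi).1
    have h2 := hρ t
    lia
  obtain ⟨B, hB⟩ := hdvd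
  refine ⟨B, ∑ i ∈ Finset.range (t + 1), b ^ (ρ i - 1), ?_, hlt t, ?_⟩
  · rw [← Finset.sum_range_add_sum_Ico _ ht, hB]; ring
  · rw [Finset.sum_range_succ]; exact Nat.le_add_left _ _

end Numbers

/-! ### Functionals that vanish on initial vectors of `w 0`. -/

section Functionals

variable {K V : Type*} [Field K] [AddCommGroup V] [Module K V]

/-- The functional with coefficients `μ 0, …, μ j` in the coordinates of a basis. -/
def coordFunctional (w : Module.Basis ℕ K V) (μ : ℕ → K) (j : ℕ) : V →ₗ[K] K :=
  ∑ k ∈ Finset.range (j + 1), μ k • w.coord k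

theorem coordFunctional_apply (w : Module.Basis ℕ K V) (μ : ℕ → K) (j : ℕ) (v : V) :
    coordFunctional w μ j v = ∑ k ∈ Finset.range (j + 1), μ k * w.repr v k := by
  simp [coordFunctional]

/-- Some normalized functional in the first `l + 1` coordinates of `w` vanishes on the first `l`
vectors of another basis. -/
theorem exists_coordFunctional (w₀ w : Module.Basis ℕ K V) (l : ℕ) :
    ∃ (j : ℕ) (μ : ℕ → K) (ρ : ℕ), j ≤ l ∧ μ j = 1 ∧ (∀ k, j < k → μ k = 0) ∧ l ≤ ρ ∧
      (∀ r < ρ, coordFunctional w μ j (w₀ r) = 0) ∧ coordFunctional w μ j (w₀ ρ) ≠ 0 := by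
  classical
  let A : (Fin (l + 1) → K) →ₗ[K] (Fin l → K) :=
    LinearMap.pi fun r => ∑ k : Fin (l + 1), w.repr (w₀ r) k • LinearMap.proj k
  have hA : ∀ c r, A c r = ∑ k : Fin (l + 1), c k * w.repr (w₀ r) k := by
    intro c r
    simp [A, mul_comm]
  -- There are `l + 1` unknown coefficients against `l` vanishing conditions.
  have hker : LinearMap.ker A ≠ ⊥ := LinearMap.ker_ne_bot_of_finrank_lt (by simp)
  obtain ⟨c, hc, hc0⟩ := Submodule.exists_mem_ne_zero_of_ne_bot hker
  have hAc : ∀ r : Fin l, ∑ k : Fin (l + 1), c k * w.repr (w₀ r) k = 0 := fun r => by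
    rw [← hA, LinearMap.mem_ker.1 hc]; rfl
  let ν : ℕ → K := fun k => if h : k < l + 1 then c ⟨k, h⟩ else 0
  have hν : ∀ k : Fin (l + 1), ν k = c k := fun k => dif_pos k.2
  obtain ⟨j, hj, hjne, hjmax⟩ : ∃ j, j ≤ l ∧ ν j ≠ 0 ∧ ∀ k, j < k → ν k = 0 := by
    obtain ⟨k₀, hk₀⟩ := Function.ne_iff.1 hc0
    refine ⟨Nat.findGreatest (fun k => ν k ≠ 0) l, Nat.findGreatest_le _,
      Nat.findGreatest_spec (P := fun k => ν k ≠ 0) (m := k₀) (by have := k₀.2; lia)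
        (by rw [hν]; exact hk₀), fun k hk => ?_⟩
    by_cases hkl : k ≤ l
    · exact not_not.1 (Nat.findGreatest_is_greatest hk hkl)
    · exact dif_neg (by lia)
  let μ : ℕ → K := fun k => (ν j)⁻¹ * ν k
  have hμj : μ j = 1 := inv_mul_cancel₀ hjne
  have hval : ∀ r < l, coordFunctional w μ j (w₀ r) = 0 := by
    intro r hr
    rw [coordFunctional_apply]
    simp only [μ, mul_assoc]
    rw [← Finset.mul_sum]
    have h1 : ∑ k ∈ Finset.range (j + 1), ν k * w.repr (w₀ r) k =
        ∑ k ∈ Finset.range (l + 1), ν k * w.repr (w₀ r) k := by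
      refine Finset.sum_subset (Finset.range_mono (by lia)) fun k _ hk => ?_
      rw [hjmax k (by rw [Finset.mem_range] at hk; lia), zero_mul]
    rw [h1, Finset.sum_range, Finset.sum_congr rfl fun k _ => by rw [hν k], hAc ⟨r, hr⟩, mul_zero]
  have hex : ∃ r, coordFunctional w μ j (w₀ r) ≠ 0 := by
    by_contra! h
    have h0 : coordFunctional w μ j = 0 := w₀.ext fun r => by rw [h r]; rfl
    have h1 := LinearMap.congr_fun h0 (w j)
    rw [coordFunctional_apply, Finset.sum_eq_single j] at h1
    · simp [hμj] at h1
    · intro k _ hk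
      simp [hk.symm]
    · simp
  refine ⟨j, μ, Nat.find hex, hj, hμj, fun k hk => by simp [μ, hjmax k hk], ?_,
    fun r hr => not_not.1 (Nat.find_min hex hr), Nat.find_spec hex⟩
  by_contra hlt
  exact Nat.find_spec hex (hval _ (not_le.1 hlt))

variable {b : ℕ} [NeZero b]

/-- Twisted sums along the points cancel in complete blocks. -/
theorem sum_comp_functional_digitPoint [Fintype K] {φ : Fin b ≃ K} (hφ : φ 0 = 0) (hb : 1 < b)
    (w : Module.Basis ℕ K V) (ℓ : V →ₗ[K] K) {ρ : ℕ} (hℓ : ∀ r < ρ, ℓ (w r) = 0)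
    (hℓρ : ℓ (w ρ) ≠ 0) {F : K → ℝ} (hF : ∑ x, F x = 0) {B N : ℕ} (hN : N < b ^ ρ) (c : K) :
    ∑ n ∈ Finset.range (B * b ^ (ρ + 1) + N), F (c - ℓ (digitPoint φ w n)) =
      N * F (c - ℓ (digitPoint φ w (B * b ^ (ρ + 1)))) := by
  have hsurj : ∀ y, ∃ n < b ^ (ρ + 1), (-ℓ) (digitPoint φ w n) = y := by
    intro y
    obtain ⟨n, hn, hv⟩ := exists_digitPoint_eq w hφ hb (R := ρ + 1)
      (v := (-y / ℓ (w ρ)) • w ρ) (fun r hr => by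
        have : ρ ≠ r := by lia
        simp [this])
    refine ⟨n, hn, ?_⟩
    rw [hv]
    simp [hℓρ]
  have hblock : ∀ c, ∑ n ∈ Finset.range (b ^ (ρ + 1)), F (c - ℓ (digitPoint φ w n)) = 0 := by
    intro c
    have h1 := sum_digitPoint_eq w hφ hb (-ℓ) hsurj F c
    rw [hF, mul_zero, mul_eq_zero] at h1
    have h2 := h1.resolve_left (Nat.cast_ne_zero.2 Fintype.card_ne_zero)
    simpa [sub_eq_add_neg] using h2
  have hshift : ∀ B' n, n < b ^ (ρ + 1) → c - ℓ (digitPoint φ w (B' * b ^ (ρ + 1) + n)) =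
      c - ℓ (digitPoint φ w (B' * b ^ (ρ + 1))) - ℓ (digitPoint φ w n) := by
    intro B' n hn
    rw [digitPoint_mul_pow_add w hφ hb hn, map_add, sub_sub]
  have hfull : ∀ B', ∑ n ∈ Finset.range (B' * b ^ (ρ + 1)), F (c - ℓ (digitPoint φ w n)) = 0 := by
    intro B'
    induction B' with
    | zero => simp
    | succ B' ih =>
      rw [Nat.succ_mul, Finset.sum_range_add, ih, zero_add,
        Finset.sum_congr rfl fun n hn => by rw [hshift B' n (Finset.mem_range.1 hn)]]
      exact hblock _
  -- The points left over after the full blocks differ only by vectors that `ℓ` kills, so their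
  -- terms are all equal.
  have hzero : ∀ n < b ^ ρ, ℓ (digitPoint φ w n) = 0 := by
    intro n hn
    rw [digitPoint, map_sum]
    refine Finset.sum_eq_zero fun r _ => ?_
    rw [map_smul]
    rcases lt_or_ge r ρ with h | h
    · rw [hℓ r h, smul_zero]
    · rw [natDigit_eq_zero (hn.trans_le (Nat.pow_le_pow_right hb.le h)), hφ, zero_smul]
  rw [Finset.sum_range_add, hfull, zero_add, Finset.sum_congr rfl fun n hn => by
    have hn' : n < b ^ ρ := (Finset.mem_range.1 hn).trans hN
    rw [hshift B n (hn'.trans_le (Nat.pow_le_pow_right hb.le (Nat.le_succ ρ))), hzero n hn',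
      sub_zero]]
  rw [Finset.sum_const, Finset.card_range, nsmul_eq_mul]

end Functionals

end HaltonFF
end

noncomputable section
namespace HaltonFF

/-! ### Bessel's inequality and functions of sum zero. -/

section Orthogonality

/-- Bessel's inequality for a function that correlates with every member of an orthogonal
family. -/
theorem card_mul_le_sum_sq {Q : Type*} [Fintype Q] {T : ℕ} {G : Q → ℝ} {H : ℕ → Q → ℝ} {η q : ℝ}
    (hη : 0 ≤ η)
    (horth : ∀ t < T, ∀ t' < T, t ≠ t' → ∑ Y, H t Y * H t' Y = 0)
    (hG : ∀ t < T, η * q ≤ ∑ Y, G Y * H t Y) (hH : ∀ t < T, ∑ Y, H t Y ^ 2 ≤ q) :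
    T * (η ^ 2 * q) ≤ ∑ Y, G Y ^ 2 := by
  -- Expanding this square with weight `η` gives the bound, without normalizing the `H t`.
  have h0 : 0 ≤ ∑ Y, (G Y - η * ∑ t ∈ Finset.range T, H t Y) ^ 2 :=
    Finset.sum_nonneg fun _ _ => sq_nonneg _
  have h1 : ∑ Y, (G Y - η * ∑ t ∈ Finset.range T, H t Y) ^ 2 =
      ∑ Y, G Y ^ 2 - 2 * η * ∑ t ∈ Finset.range T, ∑ Y, G Y * H t Y +
        η ^ 2 * ∑ t ∈ Finset.range T, ∑ t' ∈ Finset.range T, ∑ Y, H t Y * H t' Y := by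
    have h2 : ∀ Y, (G Y - η * ∑ t ∈ Finset.range T, H t Y) ^ 2 =
        G Y ^ 2 - 2 * η * ∑ t ∈ Finset.range T, G Y * H t Y +
          η ^ 2 * ∑ t ∈ Finset.range T, ∑ t' ∈ Finset.range T, H t Y * H t' Y := by
      intro Y
      rw [← Finset.mul_sum, ← Finset.sum_mul_sum]
      ring
    simp only [h2, Finset.sum_add_distrib, Finset.sum_sub_distrib, ← Finset.mul_sum]
    congr 2
    · congr 1
      simp only [Finset.mul_sum]
      exact Finset.sum_comm
    · rw [Finset.sum_comm]
      refine Finset.sum_congr rfl fun t _ => ?_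
      rw [Finset.sum_comm]
      simp only [Finset.mul_sum]
  have h3 : ∑ t ∈ Finset.range T, ∑ t' ∈ Finset.range T, ∑ Y, H t Y * H t' Y ≤ T * q := by
    have : ∀ t ∈ Finset.range T, ∑ t' ∈ Finset.range T, ∑ Y, H t Y * H t' Y ≤ q := by
      intro t ht
      rw [Finset.sum_eq_single t]
      · simpa [sq] using hH t (Finset.mem_range.1 ht)
      · exact fun t' ht' hne =>
          horth t (Finset.mem_range.1 ht) t' (Finset.mem_range.1 ht') hne.symm
      · exact fun h => absurd ht h
    refine (Finset.sum_le_sum this).trans (le_of_eq ?_)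
    simp
  have h4 : T * (η * q) ≤ ∑ t ∈ Finset.range T, ∑ Y, G Y * H t Y := by
    have := Finset.card_nsmul_le_sum (Finset.range T) (fun t => ∑ Y, G Y * H t Y) (η * q)
      fun t ht => hG t (Finset.mem_range.1 ht)
    simpa using this
  have h5 := mul_le_mul_of_nonneg_left h3 (sq_nonneg η)
  have h6 := mul_le_mul_of_nonneg_left h4 hη
  rw [h1] at h0
  nlinarith

/-- Average over translations along the line `K e`: `h` is unchanged while the argument of `F` runs
through `K`. -/
theorem sum_comp_mul_eq_zero {K Q : Type*} [Field K] [Fintype K] [AddCommGroup Q] [Module K Q]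
    [Fintype Q] {ℓ : Q →ₗ[K] K} {e : Q} (he : ℓ e ≠ 0) {F : K → ℝ} (hF : ∑ x, F x = 0)
    {h : Q → ℝ} (hinv : ∀ (Y : Q) (c : K), h (Y + c • e) = h Y) (a : K) :
    ∑ Y, F (ℓ Y + a) * h Y = 0 := by
  have h1 : (Fintype.card K : ℝ) * ∑ Y, F (ℓ Y + a) * h Y = 0 := by
    calc (Fintype.card K : ℝ) * ∑ Y, F (ℓ Y + a) * h Y
        = ∑ c : K, ∑ Y, F (ℓ (Y + c • e) + a) * h (Y + c • e) := by
          have h2 : ∀ c : K, ∑ Y, F (ℓ (Y + c • e) + a) * h (Y + c • e) =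
              ∑ Y, F (ℓ Y + a) * h Y := fun c =>
            Equiv.sum_comp (Equiv.addRight (c • e)) fun Y => F (ℓ Y + a) * h Y
          rw [Finset.sum_congr rfl fun c _ => h2 c, Finset.sum_const, Finset.card_univ,
            nsmul_eq_mul]
      _ = ∑ Y, (∑ c : K, F (ℓ Y + a + c * ℓ e)) * h Y := by
          rw [Finset.sum_comm]
          refine Finset.sum_congr rfl fun Y _ => ?_
          rw [Finset.sum_mul]
          refine Finset.sum_congr rfl fun c _ => ?_
          rw [hinv, map_add, map_smul, smul_eq_mul, add_right_comm]
      _ = 0 := by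
          refine Finset.sum_eq_zero fun Y _ => ?_
          have := Equiv.sum_comp ((Equiv.mulRight₀ (ℓ e) he).trans (Equiv.addLeft (ℓ Y + a))) F
          change ∑ c, F (ℓ Y + a + c * ℓ e) = ∑ x, F x at this
          rw [this, hF, zero_mul]
  exact (mul_eq_zero.1 h1).resolve_left (Nat.cast_ne_zero.2 Fintype.card_ne_zero)

open scoped Classical in
/-- The difference of the indicators of `c` and `c + d`. -/
def twoPoint {K : Type*} [Field K] (c d x : K) : ℝ :=
  (if x = c then 1 else 0) - if x = c + d then 1 else 0

theorem sum_twoPoint {K : Type*} [Field K] [Fintype K] (c d : K) : ∑ x, twoPoint c d x = 0 := by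
  classical
  simp only [twoPoint, Finset.sum_sub_distrib]
  rw [Finset.sum_ite_eq', Finset.sum_ite_eq']
  simp

theorem twoPoint_sq_le {K : Type*} [Field K] (c d x : K) : twoPoint c d x ^ 2 ≤ 1 := by
  unfold twoPoint
  split_ifs <;> norm_num

end Orthogonality

/-! ### Cylinders, ties and the correlation of the box with a functional. -/

section Blocks

variable {K V : Type*} {b : ℕ} [NeZero b] {s M : ℕ}

/-- The digit string of the `i`-th block of coordinates, extended by zeros. -/
def blockString (φ : Fin b ≃ K) (Y : Fin s → Fin M → K) (i : Fin s) : ℕ → Fin b :=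
  zeroExtend fun k => φ.symm (Y i k)

theorem blockString_of_lt (φ : Fin b ≃ K) (Y : Fin s → Fin M → K) (i : Fin s) {k : ℕ}
    (hk : k < M) : blockString φ Y i k = φ.symm (Y i ⟨k, hk⟩) := dif_pos hk

open scoped Classical in
theorem card_cylinder [Fintype K] (φ : Fin b ≃ K) (p : Fin s → ℕ → Fin b) {len : Fin s → ℕ}
    (hlen : ∀ i, len i ≤ M) :
    (Finset.univ.filter fun Y : Fin s → Fin M → K =>
      ∀ i, ∀ k < len i, blockString φ Y i k = p i k).card * b ^ ∑ i, len i =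
      Fintype.card (Fin s → Fin M → K) := by
  have hcardK : Fintype.card K = b := by
    rw [← Fintype.card_congr φ, Fintype.card_fin]
  have h1 : (Finset.univ.filter fun Y : Fin s → Fin M → K =>
      ∀ i, ∀ k < len i, blockString φ Y i k = p i k) =
      Fintype.piFinset fun i => Fintype.piFinset fun k : Fin M =>
        if (k : ℕ) < len i then {φ (p i k)} else Finset.univ := by
    ext Y
    simp only [Finset.mem_filter, Finset.mem_univ, true_and, Fintype.mem_piFinset]
    refine forall_congr' fun i => ⟨fun h k => ?_, fun h k hk => ?_⟩
    · split_ifs with hk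
      · have := h k hk
        rw [blockString_of_lt φ Y i k.2] at this
        rw [Finset.mem_singleton, ← this, Equiv.apply_symm_apply]
      · exact Finset.mem_univ _
    · have hkM := hk.trans_le (hlen i)
      have := h ⟨k, hkM⟩
      rw [if_pos hk, Finset.mem_singleton] at this
      rw [blockString_of_lt φ Y i hkM, this, Equiv.symm_apply_apply]
  have h2 : ∀ i, (∏ k : Fin M, (if (k : ℕ) < len i then ({φ (p i k)} : Finset K)
      else Finset.univ).card) * b ^ len i = b ^ M := by
    intro i
    have h3 : b ^ len i = ∏ k : Fin M, if (k : ℕ) < len i then b else 1 := by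
      rw [← Finset.prod_range fun k => if k < len i then b else 1, ← Finset.prod_filter,
        Finset.prod_const]
      congr 1
      rw [show (Finset.range M).filter (fun k => k < len i) = Finset.range (len i) from ?_,
        Finset.card_range]
      ext k
      have := hlen i
      simp only [Finset.mem_filter, Finset.mem_range]
      lia
    rw [h3, ← Finset.prod_mul_distrib, Finset.prod_congr rfl fun k _ => ?_, Finset.prod_const,
      Finset.card_univ, Fintype.card_fin]
    split_ifs
    · simp
    · simp [hcardK]
  rw [h1, Fintype.card_piFinset, ← Finset.prod_pow_eq_pow_sum, ← Finset.prod_mul_distrib]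
  simp only [Fintype.card_piFinset]
  rw [Finset.prod_congr rfl fun i _ => h2 i]
  simp [hcardK]

variable [Field K] [AddCommGroup V] [Module K V]

/-- The functional with coefficients `μ` on the `i`-th block of coordinates. -/
def blockFunctional (μ : ℕ → K) (i : Fin s) (M : ℕ) : (Fin s → Fin M → K) →ₗ[K] K :=
  ∑ k : Fin M, μ k • (LinearMap.proj (R := K) (φ := fun _ : Fin M => K) k ∘ₗ
    LinearMap.proj (R := K) (φ := fun _ : Fin s => Fin M → K) i)

theorem blockFunctional_apply (μ : ℕ → K) (i : Fin s) (Y : Fin s → Fin M → K) :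
    blockFunctional μ i M Y = ∑ k : Fin M, μ k * Y i k := by
  simp [blockFunctional]

theorem sum_fin_eq_sum_range {μ y : ℕ → K} {j : ℕ} (hμ : ∀ k, j < k → μ k = 0) (hj : j < M) :
    ∑ k : Fin M, μ k * y k = ∑ k ∈ Finset.range (j + 1), μ k * y k := by
  rw [← Finset.sum_range fun k => μ k * y k]
  symm
  refine Finset.sum_subset (Finset.range_mono (by lia)) fun k _ hk => ?_
  rw [hμ k (by rw [Finset.mem_range] at hk; lia), zero_mul]

theorem blockFunctional_coordMap (w : Fin (s + 1) → Module.Basis ℕ K V) {μ : ℕ → K} {j : ℕ}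
    (hμ : ∀ k, j < k → μ k = 0) (hj : j < M) (i : Fin s) (v : V) :
    blockFunctional μ i M (coordMap w M v) = coordFunctional (w i.succ) μ j v := by
  rw [blockFunctional_apply, coordFunctional_apply]
  exact sum_fin_eq_sum_range (y := fun k => (w i.succ).repr v k) hμ hj

theorem blockFunctional_eq (φ : Fin b ≃ K) {μ : ℕ → K} {j : ℕ} (hμj : μ j = 1)
    (hμ : ∀ k, j < k → μ k = 0) (hj : j < M) (i : Fin s) (Y : Fin s → Fin M → K) :
    blockFunctional μ i M Y =
      ∑ k ∈ Finset.range j, μ k * φ (blockString φ Y i k) + φ (blockString φ Y i j) := by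
  have h1 : ∀ k : Fin M, Y i k = φ (blockString φ Y i k) := fun k => by
    rw [blockString_of_lt φ Y i k.2, Equiv.apply_symm_apply]
  rw [blockFunctional_apply, Finset.sum_congr rfl fun k _ => by rw [h1 k],
    sum_fin_eq_sum_range (y := fun k => φ (blockString φ Y i k)) hμ hj, Finset.sum_range_succ, hμj,
    one_mul]

open scoped Classical in
/-- Few blocks, translated by one of `N` vectors, agree with `g` in a full coordinate. -/
theorem card_ties_le [Fintype K] (φ : Fin b ≃ K) (g : Fin s → ℕ → Fin b) (N : ℕ)
    (u : ℕ → Fin s → Fin M → K) :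
    (Finset.univ.filter fun Y : Fin s → Fin M → K =>
      ∃ n < N, ∃ i, ∀ k < M, blockString φ (u n + Y) i k = g i k).card * b ^ M ≤
      N * s * Fintype.card (Fin s → Fin M → K) := by
  have h1 : ∀ n i, (Finset.univ.filter fun Y : Fin s → Fin M → K =>
      ∀ k < M, blockString φ (u n + Y) i k = g i k).card * b ^ M =
      Fintype.card (Fin s → Fin M → K) := by
    intro n i
    have h2 := card_cylinder (M := M) φ g (len := fun i' => if i' = i then M else 0)
      (fun i' => by split_ifs <;> simp)
    rw [Finset.sum_ite_eq' Finset.univ i, if_pos (Finset.mem_univ i)] at h2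
    rw [← h2]
    congr 1
    refine Finset.card_bij (fun Y _ => u n + Y) ?_ ?_ ?_
    · intro Y hY
      simp only [Finset.mem_filter, Finset.mem_univ, true_and] at hY ⊢
      intro i' k hk
      split_ifs at hk with hi
      · subst hi; exact hY k hk
      · exact absurd hk (Nat.not_lt_zero k)
    · intro Y _ Y' _ h; exact add_left_cancel h
    · intro Y hY
      simp only [Finset.mem_filter, Finset.mem_univ, true_and] at hY
      refine ⟨Y - u n, ?_, add_sub_cancel _ _⟩
      simp only [Finset.mem_filter, Finset.mem_univ, true_and, add_sub_cancel]
      intro k hk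
      exact hY i k (by rwa [if_pos rfl])
  have h3 : (Finset.univ.filter fun Y : Fin s → Fin M → K =>
      ∃ n < N, ∃ i, ∀ k < M, blockString φ (u n + Y) i k = g i k) ⊆
      (Finset.range N).biUnion fun n => Finset.univ.biUnion fun i =>
        Finset.univ.filter fun Y : Fin s → Fin M → K =>
          ∀ k < M, blockString φ (u n + Y) i k = g i k := by
    intro Y hY
    simpa using hY
  calc _ ≤ (∑ n ∈ Finset.range N, ∑ i : Fin s, (Finset.univ.filter fun Y : Fin s → Fin M → K =>
          ∀ k < M, blockString φ (u n + Y) i k = g i k).card) * b ^ M := by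
        refine Nat.mul_le_mul_right _ ((Finset.card_le_card h3).trans ?_)
        refine Finset.card_biUnion_le.trans (Finset.sum_le_sum fun n _ => ?_)
        exact Finset.card_biUnion_le
    _ = N * s * Fintype.card (Fin s → Fin M → K) := by
        simp only [Finset.sum_mul, h1]
        rw [Finset.sum_const, Finset.sum_const, Finset.card_range, Finset.card_univ,
          Fintype.card_fin, smul_eq_mul, smul_eq_mul]
        ring

open scoped Classical in
/-- The correlation of the box with the two-point function along a functional whose leading
coefficient sits in place `j`. -/
theorem card_cylinder_le_sum_inBox [Fintype K] {φ : Fin b ≃ K} (hφ : φ 0 = 0) (hb : 1 < b)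
    {g p : Fin s → ℕ → Fin b} {len : Fin s → ℕ} {i₀ : Fin s} {j l : ℕ} {μ : ℕ → K}
    (hμj : μ j = 1) (hμ : ∀ k, j < k → μ k = 0) (hjl : j ≤ l) (hM : l + 2 < M)
    (hmix : IsMixedAt (g i₀) l) (hlen : len i₀ = l + 3) (hp₀ : p i₀ = separatingString (g i₀) j l)
    (hp : ∀ i, i ≠ i₀ → ∀ a : ℕ → Fin b, (∀ k < len i, a k = p i k) → LexLt M a (g i)) :
    ((Finset.univ.filter fun Y : Fin s → Fin M → K =>
      ∀ i, ∀ k < len i, blockString φ Y i k = p i k).card : ℝ) ≤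
    ∑ Y : Fin s → Fin M → K, (if InBox φ g Y then 1 else 0) *
      twoPoint (∑ k ∈ Finset.range j, μ k * φ (g i₀ k)) (φ ⟨b - 1, Nat.sub_one_lt_of_lt hb⟩)
        (blockFunctional μ i₀ M Y) := by
  set d := φ ⟨b - 1, Nat.sub_one_lt_of_lt hb⟩ with hd
  set c := ∑ k ∈ Finset.range j, μ k * φ (g i₀ k) with hc
  set ℓ := blockFunctional μ i₀ M with hℓ
  have hjM : j < M := by lia
  -- Translation by `e` exchanges the two values of the two-point function and changes only the
  -- digit at `j`, turning `0` into `b - 1`.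
  let e : Fin s → Fin M → K := Pi.single i₀ (Pi.single ⟨j, hjM⟩ d)
  have hℓe : ℓ e = d := by
    rw [hℓ, blockFunctional_apply, Finset.sum_eq_single ⟨j, hjM⟩]
    · simp [e, hμj]
    · intro k _ hk
      simp [e, hk]
    · simp
  have hstr : ∀ Y i k, (i ≠ i₀ ∨ k ≠ j) → blockString φ (Y + e) i k = blockString φ Y i k := by
    intro Y i k hik
    by_cases hk : k < M
    · rw [blockString_of_lt _ _ _ hk, blockString_of_lt _ _ _ hk]
      congr 1
      have : e i ⟨k, hk⟩ = 0 := by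
        by_cases hi : i = i₀
        · subst hi
          have hkj : (⟨k, hk⟩ : Fin M) ≠ ⟨j, hjM⟩ := fun h =>
            (hik.resolve_left (fun h => h rfl)) (congrArg Fin.val h)
          simp [e, hkj]
        · simp [e, hi]
      rw [Pi.add_apply, Pi.add_apply, this, add_zero]
    · unfold blockString zeroExtend
      rw [dif_neg hk, dif_neg hk]
  have hstrj : ∀ Y, blockString φ Y i₀ j = 0 →
      (blockString φ (Y + e) i₀ j : ℕ) = b - 1 := by
    intro Y hY
    rw [blockString_of_lt _ _ _ hjM] at hY ⊢
    have h1 : Y i₀ ⟨j, hjM⟩ = 0 := by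
      rw [← hφ, ← hY, Equiv.apply_symm_apply]
    have h2 : (Y + e) i₀ ⟨j, hjM⟩ = d := by
      rw [Pi.add_apply, Pi.add_apply, h1]; simp [e]
    rw [h2, hd, Equiv.symm_apply_apply]
  -- No term is negative: if the first `j` digits tie with `g i₀`, the choice of `c` forces the
  -- digit at `j` to be `0`. The cylinder then contributes `1` per element.
  have hmono : ∀ Y, ℓ Y = c → InBox φ g (Y + e) → InBox φ g Y := by
    intro Y hY hbox i
    by_cases hi : i = i₀
    · subst hi
      refine lexLt_of_lexLt_of_eq_off hb hjM (fun k hk => (hstr Y i k (Or.inr hk)).symm)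
        (fun hpre => ?_) (hbox i)
      have h1 := blockFunctional_eq φ hμj hμ hjM i Y
      rw [← hℓ, hY, Finset.sum_congr rfl fun k hk => by
        rw [show blockString φ Y i k = g i k from hpre k (Finset.mem_range.1 hk)], ← hc,
        left_eq_add, ← hφ] at h1
      have h2 := φ.injective h1
      exact ⟨h2, hstrj Y h2⟩
    · exact (lexLt_congr (a' := blockString φ Y i) fun k _ => hstr Y i k (Or.inl hi)).1 (hbox i)
  have hshift : ∑ Y, (if InBox φ g Y then (1 : ℝ) else 0) * (if ℓ Y = c + d then 1 else 0) =
      ∑ Y, (if InBox φ g (Y + e) then (1 : ℝ) else 0) * (if ℓ Y = c then 1 else 0) := by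
    rw [← Equiv.sum_comp (Equiv.addRight e)]
    refine Finset.sum_congr rfl fun Y _ => ?_
    have h1 : ℓ (Y + e) = c + d ↔ ℓ Y = c := by rw [map_add, hℓe, add_left_inj]
    simp only [Equiv.coe_addRight, h1]
    congr
  have hsum : ∑ Y, (if InBox φ g Y then (1 : ℝ) else 0) * twoPoint c d (ℓ Y) =
      ∑ Y, ((if InBox φ g Y then (1 : ℝ) else 0) - (if InBox φ g (Y + e) then 1 else 0)) *
        (if ℓ Y = c then 1 else 0) := by
    simp only [twoPoint, mul_sub, sub_mul, Finset.sum_sub_distrib]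
    rw [hshift]
  rw [hsum, Finset.card_filter, Nat.cast_sum]
  refine Finset.sum_le_sum fun Y _ => ?_
  by_cases hcyl : ∀ i, ∀ k < len i, blockString φ Y i k = p i k
  · have h₀ : ∀ k < l + 3, blockString φ Y i₀ k = separatingString (g i₀) j l k := fun k hk => by
      rw [hcyl i₀ k (by lia), hp₀]
    have hin : InBox φ g Y := fun i => by
      by_cases hi : i = i₀
      · subst hi
        exact lexLt_of_eq_separatingString hb hjl hM hmix h₀
      · exact hp i hi _ (hcyl i)
    have hj0 : blockString φ Y i₀ j = 0 := by rw [h₀ j (by lia), separatingString, if_pos rfl]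
    have hout : ¬ InBox φ g (Y + e) := fun h =>
      not_lexLt_of_eq_separatingString hjl hmix
        (fun k hk hkj => by rw [← h₀ k hk]; exact hstr Y i₀ k (Or.inr hkj)) (hstrj Y hj0) (h i₀)
    have hval : ℓ Y = c := by
      rw [hℓ, blockFunctional_eq φ hμj hμ hjM, hj0, hφ, add_zero, hc]
      refine Finset.sum_congr rfl fun k hk => ?_
      have hk' := Finset.mem_range.1 hk
      rw [h₀ k (by lia), separatingString, if_neg (by lia), if_pos (by lia)]
    rw [if_pos hcyl, if_pos hin, if_neg hout, if_pos hval]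
    simp
  · rw [if_neg hcyl, Nat.cast_zero]
    by_cases hval : ℓ Y = c
    · rw [if_pos hval, mul_one, sub_nonneg]
      by_cases h : InBox φ g (Y + e)
      · rw [if_pos h, if_pos (hmono Y hval h)]
      · rw [if_neg h]; split_ifs <;> simp
    · rw [if_neg hval, mul_zero]

end Blocks

end HaltonFF
end

noncomputable section
namespace HaltonFF

/-! ### Bounded remainder implies finitely many digits. -/

section Necessity

variable {K V : Type*} [Field K] [AddCommGroup V] [Module K V] {b : ℕ} [NeZero b] {s : ℕ}

open scoped Classical in
/-- The discrepancy function of the first `N` points, translated by `Y`, with respect to the box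
seen by the first `M` digits. -/
def blockDiscrepancy (φ : Fin b ≃ K) (g : Fin s → ℕ → Fin b)
    (w : Fin (s + 1) → Module.Basis ℕ K V) (M N : ℕ) (lam : ℝ) (Y : Fin s → Fin M → K) : ℝ :=
  ∑ n ∈ Finset.range N,
    ((if InBox φ g (coordMap w M (digitPoint φ (w 0) n) + Y) then 1 else 0) - lam)

theorem abs_blockDiscrepancy_le (φ : Fin b ≃ K) (g : Fin s → ℕ → Fin b)
    (w : Fin (s + 1) → Module.Basis ℕ K V) (M N : ℕ) (lam : ℝ) (Y : Fin s → Fin M → K) :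
    |blockDiscrepancy φ g w M N lam Y| ≤ N * (1 + |lam|) := by
  refine (Finset.abs_sum_le_sum_abs _ _).trans ?_
  refine (Finset.sum_le_card_nsmul _ _ (1 + |lam|) fun n _ => ?_).trans
    (le_of_eq (by rw [Finset.card_range, nsmul_eq_mul]))
  refine (abs_sub _ _).trans (add_le_add_left ?_ _)
  split_ifs <;> simp

open scoped Classical in
/-- Away from ties, the block discrepancy is a difference of two values of the discrepancy
function of the sequence. -/
theorem abs_blockDiscrepancy_le_of_bounded {φ : Fin b ≃ K} (hφ : φ 0 = 0) (hb : 1 < b)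
    {g : Fin s → ℕ → Fin b} {w : Fin (s + 1) → Module.Basis ℕ K V} (hw : JointlyIndependent w)
    {C lam : ℝ}
    (hC : ∀ N : ℕ, |∑ n ∈ Finset.range N,
      ((if ∀ i, ∃ M, LexLt M (digitString φ (w i.succ) (digitPoint φ (w 0) n)) (g i)
        then (1 : ℝ) else 0) - lam)| ≤ C) {M N : ℕ} {Y : Fin s → Fin M → K}
    (hY : ¬ ∃ n < N, ∃ i, ∀ k < M,
      blockString φ (coordMap w M (digitPoint φ (w 0) n) + Y) i k = g i k) :
    |blockDiscrepancy φ g w M N lam Y| ≤ 2 * C := by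
  -- The translation is realized inside the sequence: `Y` comes from a vector whose first `N`
  -- coordinates in `w 0` vanish, so it is the point at some `B * b ^ N`, to which `n < N` adds
  -- without carry.
  obtain ⟨v, hv0, hv⟩ := hw.exists_coordMap_eq M N Y
  obtain ⟨B, hB⟩ := exists_digitPoint_mul_pow_eq (w 0) hφ hb hv0
  have hbox : ∀ n < N, (InBox φ g (coordMap w M (digitPoint φ (w 0) n) + Y) ↔
      ∀ i, ∃ M, LexLt M (digitString φ (w i.succ) (digitPoint φ (w 0) (B * b ^ N + n))) (g i)) := by
    intro n hn
    have h1 : coordMap w M (digitPoint φ (w 0) n) + Y =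
        coordMap w M (digitPoint φ (w 0) (B * b ^ N + n)) := by
      rw [digitPoint_mul_pow_add (w 0) hφ hb (hn.trans (Nat.lt_pow_self hb)), map_add, hB, hv,
        add_comm]
    rw [h1, inBox_coordMap]
    refine forall_congr' fun i => ⟨fun h => ⟨M, h⟩, ?_⟩
    rintro ⟨M', k, -, hag, hlt⟩
    refine ⟨k, ?_, hag, hlt⟩
    by_contra hk
    refine hY ⟨n, hn, i, fun k' hk' => ?_⟩
    rw [h1, blockString_of_lt _ _ _ hk', ← hag k' (by lia)]
    rfl
  have h2 : blockDiscrepancy φ g w M N lam Y =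
      ∑ n ∈ Finset.range (B * b ^ N + N),
        ((if ∀ i, ∃ M, LexLt M (digitString φ (w i.succ) (digitPoint φ (w 0) n)) (g i)
          then (1 : ℝ) else 0) - lam) -
      ∑ n ∈ Finset.range (B * b ^ N),
        ((if ∀ i, ∃ M, LexLt M (digitString φ (w i.succ) (digitPoint φ (w 0) n)) (g i)
          then (1 : ℝ) else 0) - lam) := by
    rw [Finset.sum_range_add, add_sub_cancel_left]
    refine Finset.sum_congr rfl fun n hn => ?_
    simp only [hbox n (Finset.mem_range.1 hn)]
  rw [h2, two_mul]
  exact (abs_sub _ _).trans (add_le_add (hC _) (hC _))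

/-- Blocks with a tie have proportion at most `N * s / b ^ M`. For large `M` this outweighs the
trivial bound there, and they contribute at most the `+ 1`. -/
theorem sum_sq_blockDiscrepancy_le [Fintype K] {φ : Fin b ≃ K} (hb : 1 < b)
    {g : Fin s → ℕ → Fin b} {w : Fin (s + 1) → Module.Basis ℕ K V}
    {C lam : ℝ}
    (hC : ∀ N : ℕ, ∀ M, ∀ Y : Fin s → Fin M → K, (¬ ∃ n < N, ∃ i, ∀ k < M,
      blockString φ (coordMap w M (digitPoint φ (w 0) n) + Y) i k = g i k) →
      |blockDiscrepancy φ g w M N lam Y| ≤ 2 * C) {M N : ℕ}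
    (hM : (N * (1 + |lam|)) ^ 2 * (N * s) ≤ (b : ℝ) ^ M) :
    ∑ Y, blockDiscrepancy φ g w M N lam Y ^ 2 ≤
      (4 * C ^ 2 + 1) * Fintype.card (Fin s → Fin M → K) := by
  classical
  set q : ℝ := (Fintype.card (Fin s → Fin M → K) : ℝ) with hq
  set A : ℝ := (N * (1 + |lam|)) ^ 2 with hA
  set E : Finset (Fin s → Fin M → K) := Finset.univ.filter fun Y =>
    ∃ n < N, ∃ i, ∀ k < M,
      blockString φ (coordMap w M (digitPoint φ (w 0) n) + Y) i k = g i k with hE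
  have hpt : ∀ Y, blockDiscrepancy φ g w M N lam Y ^ 2 ≤ 4 * C ^ 2 + if Y ∈ E then A else 0 := by
    intro Y
    split_ifs with h
    · have h1 := abs_blockDiscrepancy_le φ g w M N lam Y
      have h2 := pow_le_pow_left₀ (abs_nonneg _) h1 2
      rw [sq_abs] at h2
      have := sq_nonneg C
      linarith
    · have h1 := hC N M Y (by simpa [hE] using h)
      have h2 := pow_le_pow_left₀ (abs_nonneg _) h1 2
      rw [sq_abs] at h2
      linarith
  have hcard : (E.card : ℝ) * (b : ℝ) ^ M ≤ N * s * q := by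
    have := card_ties_le φ g N fun n => coordMap w M (digitPoint φ (w 0) n)
    rw [hq]
    exact_mod_cast this
  have hbM : (0 : ℝ) < (b : ℝ) ^ M := by
    have : (0 : ℝ) < b := by exact_mod_cast NeZero.pos b
    positivity
  have hEA : (E.card : ℝ) * A ≤ q := by
    have hA0 : 0 ≤ A := sq_nonneg _
    have hq0 : 0 ≤ q := Nat.cast_nonneg _
    have h1 := mul_le_mul_of_nonneg_left hcard hA0
    have h2 := mul_le_mul_of_nonneg_right hM hq0
    refine le_of_mul_le_mul_right ?_ hbM
    linarith
  calc ∑ Y, blockDiscrepancy φ g w M N lam Y ^ 2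
      ≤ ∑ Y, (4 * C ^ 2 + if Y ∈ E then A else 0) := Finset.sum_le_sum fun Y _ => hpt Y
    _ = 4 * C ^ 2 * q + E.card * A := by
        rw [Finset.sum_add_distrib, Finset.sum_const, Finset.card_univ, nsmul_eq_mul,
          Finset.sum_ite_mem, Finset.univ_inter, Finset.sum_const, nsmul_eq_mul, mul_comm]
    _ ≤ (4 * C ^ 2 + 1) * q := by linarith

/-- The correlation of the block discrepancy with a translated two-point function. -/
theorem sum_blockDiscrepancy_mul [Fintype K] {φ : Fin b ≃ K} (hφ : φ 0 = 0) (hb : 1 < b)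
    {g : Fin s → ℕ → Fin b} {w : Fin (s + 1) → Module.Basis ℕ K V} {M j ρ B N : ℕ} {lam : ℝ}
    {i₀ : Fin s} {μ : ℕ → K} (hμ : ∀ k, j < k → μ k = 0) (hj : j < M)
    (hℓ : ∀ r < ρ, coordFunctional (w i₀.succ) μ j (w 0 r) = 0)
    (hℓρ : coordFunctional (w i₀.succ) μ j (w 0 ρ) ≠ 0) (hN : N < b ^ ρ) {F : K → ℝ}
    (hF : ∑ x, F x = 0) [DecidablePred fun Y : Fin s → Fin M → K => InBox φ g Y] :
    ∑ Y, blockDiscrepancy φ g w M (B * b ^ (ρ + 1) + N) lam Y *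
        F (blockFunctional μ i₀ M Y +
          coordFunctional (w i₀.succ) μ j (digitPoint φ (w 0) (B * b ^ (ρ + 1)))) =
      N * ∑ Y : Fin s → Fin M → K, (if InBox φ g Y then 1 else 0) *
        F (blockFunctional μ i₀ M Y) := by
  set ℓ := blockFunctional μ i₀ M
  set ℓ' := coordFunctional (w i₀.succ) μ j
  set c := ℓ' (digitPoint φ (w 0) (B * b ^ (ρ + 1)))
  have hrel : ∀ v, ℓ (coordMap w M v) = ℓ' v := blockFunctional_coordMap w hμ hj i₀
  have hzero : ∑ Y, F (ℓ Y + c) = 0 := by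
    have := sum_comp_mul_eq_zero (ℓ := ℓ) (e := coordMap w M (w 0 ρ)) (by rwa [hrel]) hF
      (h := fun _ => 1) (fun _ _ => rfl) c
    simpa using this
  -- The constant `lam` drops out against a function of sum zero, and a change of variable moves the
  -- `n`-th point from the box into the argument of `F`.
  have hterm : ∀ n, ∑ Y, ((if InBox φ g (coordMap w M (digitPoint φ (w 0) n) + Y) then (1 : ℝ)
      else 0) - lam) * F (ℓ Y + c) =
      ∑ Y, (if InBox φ g Y then (1 : ℝ) else 0) * F (ℓ Y + c - ℓ' (digitPoint φ (w 0) n)) := by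
    intro n
    simp only [sub_mul, Finset.sum_sub_distrib]
    rw [← Finset.mul_sum, hzero, mul_zero, sub_zero,
      ← Equiv.sum_comp (Equiv.addLeft (coordMap w M (digitPoint φ (w 0) n)))
        fun Y => (if InBox φ g Y then (1 : ℝ) else 0) * F (ℓ Y + c - ℓ' (digitPoint φ (w 0) n))]
    refine Finset.sum_congr rfl fun Y _ => ?_
    rw [Equiv.coe_addLeft, map_add, hrel]
    congr 2
    abel
  calc _ = ∑ n ∈ Finset.range (B * b ^ (ρ + 1) + N), ∑ Y,
        ((if InBox φ g (coordMap w M (digitPoint φ (w 0) n) + Y) then (1 : ℝ) else 0) - lam) *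
          F (ℓ Y + c) := by
        rw [Finset.sum_comm]
        refine Finset.sum_congr rfl fun Y _ => ?_
        rw [blockDiscrepancy, Finset.sum_mul]
        refine Finset.sum_congr rfl fun n _ => ?_
        congr
    _ = ∑ Y, (if InBox φ g Y then (1 : ℝ) else 0) * ∑ n ∈ Finset.range (B * b ^ (ρ + 1) + N),
          F (ℓ Y + c - ℓ' (digitPoint φ (w 0) n)) := by
        rw [Finset.sum_congr rfl fun n _ => hterm n, Finset.sum_comm]
        simp only [Finset.mul_sum]
    _ = _ := by
        rw [Finset.mul_sum]
        refine Finset.sum_congr rfl fun Y _ => ?_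
        rw [sum_comp_functional_digitPoint hφ hb (w 0) ℓ' hℓ hℓρ hF hN, add_sub_cancel_right]
        ring

theorem exists_digit_ne_zero (hb : 1 < b) {γ : ℝ} (hγ : γ ∈ Set.Ioo (0 : ℝ) 1) :
    ∃ k, Real.digits γ b k ≠ 0 := by
  by_contra! h
  have h1 := Real.ofDigits_digits hb (Set.Ioo_subset_Ico_self hγ)
  have h2 : Real.ofDigits (Real.digits γ b) = 0 := by
    rw [Real.ofDigits]
    refine (tsum_congr fun i => ?_).trans tsum_zero
    simp [Real.ofDigitsTerm, h i]
  exact hγ.1.ne' (h1.symm.trans h2)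

/-- A sequence of functionals, normalized at their leading places `j t`, which lie at or before
mixed places `l t` of `g`, with rapidly increasing first indices `ρ t` of non-vanishing. -/
theorem exists_functional_sequence (w₀ w : Module.Basis ℕ K V) {g : ℕ → Fin b}
    (hinf : {j | g j ≠ 0}.Infinite) (hlast : ∀ l, ∃ k, l ≤ k ∧ (g k : ℕ) ≠ b - 1) :
    ∃ (l j ρ : ℕ → ℕ) (μ : ℕ → ℕ → K), (∀ t, IsMixedAt g (l t)) ∧ (∀ t, 1 ≤ l t) ∧
      (∀ t, j t ≤ l t) ∧ (∀ t, μ t (j t) = 1) ∧ (∀ t k, j t < k → μ t k = 0) ∧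
      (∀ t, l t ≤ ρ t) ∧ (∀ t, ∀ r < ρ t, coordFunctional w (μ t) (j t) (w₀ r) = 0) ∧
      (∀ t, coordFunctional w (μ t) (j t) (w₀ (ρ t)) ≠ 0) ∧ ∀ t, ρ t + 2 ≤ ρ (t + 1) := by
  choose L hL hmix using exists_isMixedAt hinf hlast
  choose J μ P hJ hμJ hμ hP hzero hne using fun n => exists_coordFunctional w₀ w (L n)
  -- Each search starts two places after the previous `ρ`, which gives the gap; the start at `1`
  -- ensures `1 ≤ l t`.
  let N : ℕ → ℕ := fun t => Nat.rec 1 (fun _ m => P m + 2) t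
  have hN1 : ∀ t, 1 ≤ N t := by
    intro t
    cases t with
    | zero => exact le_rfl
    | succ t => change 1 ≤ P (N t) + 2; lia
  refine ⟨fun t => L (N t), fun t => J (N t), fun t => P (N t), fun t => μ (N t),
    fun t => hmix _, fun t => (hN1 t).trans (hL _), fun t => hJ _, fun t => hμJ _,
    fun t => hμ _, fun t => hP _, fun t => hzero _, fun t => hne _, fun t => ?_⟩
  have h1 : N (t + 1) = P (N t) + 2 := rfl
  have h2 := hL (N (t + 1))
  have h3 := hP (N (t + 1))
  lia

theorem finite_digits_of_isBoundedRemainderSet [Finite K] {φ : Fin b ≃ K} (hφ : φ 0 = 0)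
    (hb : 1 < b) {w : Fin (s + 1) → Module.Basis ℕ K V} (hw : JointlyIndependent w)
    {γ : Fin s → ℝ} (hγ : ∀ i, γ i ∈ Set.Ioo (0 : ℝ) 1)
    (hS : IsBoundedRemainderSet (digitalSequence φ (transitionMatrix w))
      (Set.univ.pi fun i => Set.Ico 0 (γ i))) (i₀ : Fin s) :
    {j : ℕ | Real.digits (γ i₀) b j ≠ 0}.Finite := by
  classical
  have := Fintype.ofFinite K
  by_contra hinf
  obtain ⟨C, hC⟩ := hS
  set lam := (MeasureTheory.volume (Set.univ.pi fun i => Set.Ico 0 (γ i))).toReal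
  set g : Fin s → ℕ → Fin b := fun i => Real.digits (γ i) b with hg
  have hC' : ∀ N : ℕ, |∑ n ∈ Finset.range N,
      ((if ∀ i, ∃ M, LexLt M (digitString φ (w i.succ) (digitPoint φ (w 0) n)) (g i)
        then (1 : ℝ) else 0) - lam)| ≤ C := by
    intro N
    refine le_trans (le_of_eq ?_) (hC N)
    congr 1
    refine Finset.sum_congr rfl fun n _ => ?_
    rw [Set.indicator_apply]
    simp only [digitalSequence_mem_box_iff hφ hb w hγ]
    rfl
  obtain ⟨l, j, ρ, μ, hmix, hl1, hjl, hμj, hμ, hlρ, hzero, hne, hgap⟩ :=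
    exists_functional_sequence (w 0) (w i₀.succ) (g := g i₀) hinf
      (exists_digit_ne_last hb (Set.Ioo_subset_Ico_self (hγ i₀)))
  have hρmono : StrictMono ρ := strictMono_nat_of_lt_succ fun t => by have := hgap t; lia
  choose κ hκ using fun i => exists_digit_ne_zero hb (hγ i)
  set k' := ∑ i ∈ Finset.univ.erase i₀, (κ i + 1) with hk'
  have hb0 : (0 : ℝ) < b := by exact_mod_cast NeZero.pos b
  -- The cylinder for `t` fixes `l t + 3 + k'` digits and at least `b ^ (l t - 1)` points remain
  -- uncancelled; the quotient is free of `t`.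
  set η : ℝ := ((b : ℝ) ^ (k' + 4))⁻¹ with hη
  have hη0 : 0 < η := by positivity
  obtain ⟨T, hT⟩ := exists_nat_gt ((4 * C ^ 2 + 1) / η ^ 2)
  set N := ∑ t ∈ Finset.range T, b ^ (ρ t - 1) with hN
  obtain ⟨M, hMl, hMκ, hMN⟩ : ∃ M, (∀ t < T, l t + 2 < M) ∧ (∀ i, κ i + 1 ≤ M) ∧
      (N * (1 + |lam|)) ^ 2 * (N * s) ≤ (b : ℝ) ^ M := by
    set M := ∑ t ∈ Finset.range T, (l t + 3) + ∑ i, (κ i + 1) +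
      ⌈((N : ℝ) * (1 + |lam|)) ^ 2 * (N * s)⌉₊ with hM
    refine ⟨M, fun t ht => ?_, fun i => ?_, ?_⟩
    · have := Finset.single_le_sum (f := fun t => l t + 3) (fun _ _ => Nat.zero_le _)
        (Finset.mem_range.2 ht)
      lia
    · have := Finset.single_le_sum (f := fun i => κ i + 1) (fun _ _ => Nat.zero_le _)
        (Finset.mem_univ i)
      lia
    · refine (Nat.le_ceil _).trans ?_
      have h1 : ⌈((N : ℝ) * (1 + |lam|)) ^ 2 * (N * s)⌉₊ ≤ b ^ M :=
        (Nat.le_add_left _ _).trans (Nat.lt_pow_self hb).le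
      exact_mod_cast h1
  have hupper := sum_sq_blockDiscrepancy_le hb (w := w) (g := g) (lam := lam)
    (fun N M Y => abs_blockDiscrepancy_le_of_bounded hφ hb hw hC') hMN
  set q : ℝ := (Fintype.card (Fin s → Fin M → K) : ℝ) with hq
  have hq0 : 0 < q := Nat.cast_pos.2 Fintype.card_pos
  choose B m hBm hm hm' using fun t (ht : t < T) =>
    exists_add_of_sum_pow hb (fun t => (hl1 t).trans (hlρ t)) hgap ht
  let F : ℕ → K → ℝ := fun t =>
    twoPoint (∑ k ∈ Finset.range (j t), μ t k * φ (g i₀ k)) (φ ⟨b - 1, Nat.sub_one_lt_of_lt hb⟩)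
  let c : ℕ → K := fun t => if ht : t < T then
    coordFunctional (w i₀.succ) (μ t) (j t) (digitPoint φ (w 0) (B t ht * b ^ (ρ t + 1))) else 0
  let H : ℕ → (Fin s → Fin M → K) → ℝ := fun t Y => F t (blockFunctional (μ t) i₀ M Y + c t)
  have hjM : ∀ t < T, j t < M := fun t ht => by
    have := hjl t
    have := hMl t ht
    lia
  -- The vector `w 0 (ρ t)` is seen by the functional of `t` but killed by that of any later `t'`,
  -- since `ρ t < ρ t'`.
  have horth' : ∀ t < T, ∀ t' < T, t < t' → ∑ Y, H t Y * H t' Y = 0 := by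
    intro t ht t' ht' htt
    refine sum_comp_mul_eq_zero (e := coordMap w M (w 0 (ρ t))) ?_ (sum_twoPoint _ _) ?_ (c t)
    · rw [blockFunctional_coordMap w (hμ t) (hjM t ht)]
      exact hne t
    · intro Y a
      simp only [H]
      rw [map_add, map_smul, blockFunctional_coordMap w (hμ t') (hjM t' ht'),
        hzero t' (ρ t) (hρmono htt), smul_zero, add_zero]
  have horth : ∀ t < T, ∀ t' < T, t ≠ t' → ∑ Y, H t Y * H t' Y = 0 := by
    intro t ht t' ht' htt
    rcases lt_or_gt_of_ne htt with h | h
    · exact horth' t ht t' ht' h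
    · simp only [mul_comm (H t _)]
      exact horth' t' ht' t ht h
  have hH : ∀ t < T, ∑ Y, H t Y ^ 2 ≤ q := by
    intro t _
    refine (Finset.sum_le_sum fun Y _ => twoPoint_sq_le _ _ _).trans (le_of_eq ?_)
    simp [hq]
  have hG : ∀ t < T, η * q ≤ ∑ Y, blockDiscrepancy φ g w M N lam Y * H t Y := by
    intro t ht
    have h1 := sum_blockDiscrepancy_mul hφ hb (g := g) (B := B t ht) (lam := lam) (hμ t)
      (hjM t ht) (hzero t) (hne t) (hm t ht) (F := F t) (sum_twoPoint _ _)
    have hct : c t = coordFunctional (w i₀.succ) (μ t) (j t)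
        (digitPoint φ (w 0) (B t ht * b ^ (ρ t + 1))) := dif_pos ht
    rw [← hBm t ht, ← hN, ← hct] at h1
    change _ ≤ ∑ Y, blockDiscrepancy φ g w M N lam Y * F t (blockFunctional (μ t) i₀ M Y + c t)
    rw [h1]
    -- In the other coordinates a `0` at the nonzero digit `κ i` of `γ i` puts the point inside the
    -- box at a cost independent of `t`.
    let p : Fin s → ℕ → Fin b := fun i => if i = i₀ then separatingString (g i₀) (j t) (l t) else
      fun k => if k = κ i then 0 else g i k
    let len : Fin s → ℕ := fun i => if i = i₀ then l t + 3 else κ i + 1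
    have hlen : ∀ i, len i ≤ M := fun i => by
      simp only [len]
      split_ifs
      · have := hMl t ht; lia
      · exact hMκ i
    have hsum : ∑ i, len i = l t + 3 + k' := by
      rw [← Finset.add_sum_erase _ _ (Finset.mem_univ i₀), hk']
      congr 1
      · exact if_pos rfl
      · exact Finset.sum_congr rfl fun i hi => if_neg (Finset.ne_of_mem_erase hi)
    have h2 := card_cylinder_le_sum_inBox hφ hb (g := g) (p := p) (len := len) (i₀ := i₀)
      (hμj t) (hμ t) (hjl t) (hMl t ht) (hmix t) (if_pos rfl) (if_pos rfl) (by
        intro i hi a ha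
        simp only [len, p, if_neg hi] at ha
        refine ⟨κ i, hMκ i, fun k hk => ?_, ?_⟩
        · rw [ha k (by lia), if_neg (by lia)]
        · rw [ha (κ i) (by lia), if_pos rfl]
          exact Fin.pos_iff_ne_zero.2 (hκ i))
    have h3 := card_cylinder (K := K) (M := M) φ p hlen
    rw [hsum] at h3
    set cyl := (Finset.univ.filter fun Y : Fin s → Fin M → K =>
      ∀ i, ∀ k < len i, blockString φ Y i k = p i k).card
    have h4 : (cyl : ℝ) * (b : ℝ) ^ (l t + 3 + k') = q := by
      rw [hq]
      exact_mod_cast h3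
    have h5 : (b : ℝ) ^ (l t - 1) ≤ m t ht := by
      have h6 : b ^ (l t - 1) ≤ m t ht :=
        (Nat.pow_le_pow_right hb.le (Nat.sub_le_sub_right (hlρ t) 1)).trans (hm' t ht)
      exact_mod_cast h6
    have h7 : η * q = (b : ℝ) ^ (l t - 1) * cyl := by
      rw [← h4, hη, show l t + 3 + k' = (k' + 4) + (l t - 1) by have := hl1 t; lia, pow_add]
      field_simp
      ring
    rw [h7]
    exact mul_le_mul h5 h2 (Nat.cast_nonneg _) (Nat.cast_nonneg _)
  have hlower := card_mul_le_sum_sq hη0.le horth hG hH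
  have h8 := hlower.trans hupper
  rw [← mul_assoc] at h8
  have h9 := le_of_mul_le_mul_right h8 hq0
  rw [div_lt_iff₀ (by positivity)] at hT
  linarith

end Necessity

end HaltonFF
end

theorem theorem3 {K F : Type*} [Field K] [Finite K] [Field F] [Algebra K F]
    [Algebra (RatFunc K) F] [IsScalarTower K (RatFunc K) F] [FunctionField K F]
    (hK : algebraicClosure K F = ⊥)
    (b : ℕ) [NeZero b] (hb : Nat.card K = b) (φ : Fin b ≃ K) (hφ : φ 0 = 0)
    (s : ℕ) (hs : 1 ≤ s)
    (Pinf P₀ : HaltonFF.Place K F) (P : Fin s → ℕ → HaltonFF.Place K F)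
    (hPinf : Pinf.deg = 1) (hP₀ : P₀ ≠ Pinf)
    (hP_ne : ∀ i i' : Fin s, i ≠ i' → ∀ j j' : ℕ, P i j ≠ P i' j')
    (hP_ne_P₀ : ∀ (i : Fin s) (j : ℕ), P i j ≠ P₀)
    (hP_ne_Pinf : ∀ (i : Fin s) (j : ℕ), P i j ≠ Pinf)
    (w : Fin (s + 1) → Module.Basis ℕ K (HaltonFF.holomorphyRing Pinf))
    (hw : ∀ i : Fin (s + 1),
      HaltonFF.IsBlockSequence Pinf (HaltonFF.placeChain P₀ P i) (fun l => (w i l : F)))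
    (γ : Fin s → ℝ) (hγ : ∀ i, γ i ∈ Set.Ioo (0 : ℝ) 1) :
    HaltonFF.IsBoundedRemainderSet
        (HaltonFF.digitalSequence φ (HaltonFF.generatingMatrix w))
        (Set.univ.pi fun i => Set.Ico 0 (γ i)) ↔
      ∀ i, {j : ℕ | Real.digits (γ i) b j ≠ 0}.Finite := by
  have hb1 : 1 < b := hb ▸ Finite.one_lt_card
  have hQ : ∀ i k, HaltonFF.placeChain P₀ P i k ≠ Pinf := fun i k => by
    cases i using Fin.cases with
    | zero => exact hP₀
    | succ i => exact hP_ne_Pinf i k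
  have hdisj : ∀ i i', i ≠ i' → ∀ k k',
      HaltonFF.placeChain P₀ P i k ≠ HaltonFF.placeChain P₀ P i' k' := fun i i' hii k k' => by
    cases i using Fin.cases with
    | zero =>
      cases i' using Fin.cases with
      | zero => exact absurd rfl hii
      | succ i' => exact (hP_ne_P₀ i' k').symm
    | succ i =>
      cases i' using Fin.cases with
      | zero => exact hP_ne_P₀ i k
      | succ i' => exact hP_ne i i' (fun h => hii (congrArg Fin.succ h)) k k'
  have hjoint : HaltonFF.JointlyIndependent w := fun m e =>
    HaltonFF.exists_repr_eq hK hQ hdisj w hw m e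
  -- `generatingMatrix w` and `transitionMatrix w` agree by definition.
  exact ⟨HaltonFF.finite_digits_of_isBoundedRemainderSet hφ hb1 hjoint hγ,
    HaltonFF.isBoundedRemainderSet_of_finite_digits hφ hb1 hjoint hγ⟩
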